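/- Let $X$ be a connected (Hausdorff) complex manifold of dimension $n$ with a global holomorphic frame $\omega=(\omega^1,\dots,\omega^n)$ of the holomorphic cotangent bundle $\mathbf{T}(X)^*$ such that $d\omega^j=0$ for $1\le j\le n$ (Cond A). Let $P\Delta=\{\zeta\in\mathbb{C}^n: |\zeta^j|<1,\ 1\le j\le n\}$ be the unit polydisk. For a subdomain $\Omega\subset X$ and $a\in\Omega$, the Abelian integral $\alpha(x)=\left(\int_a^x\omega^1,\dots,\int_a^x\omega^n\right)$ has, on a small polydisk $r_0P\Delta$, a local holomorphic inverse $\phi_{a,r_0}$ with $\phi_{a,r_0}(0)=a$. For $r\ge r_0$ let $\phi_{a,r}:rP\Delta\to X$ denote its analytic extension to $rP\Delta$, whenever it exists, and set $$\rho(a,\Omega)=\sup\{r>0:\ \phi_{a,r}:rP\Delta\to X \text{ exists and } \phi_{a,r}(rP\Delta)\subset\Omega\}\in(0,\infty].$$ For $A\subset\Omega$ put $\rho(A,\Omega)=\inf_{a\in A}\rho(a,\Omega)$. Let $\mathcal{O}(\Omega)$ be the set of holomorphic functions on $\Omega$, and for a compact set $K\subset\Omega$ let $\hat K_\Omega=\{x\in\Omega: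 |f(x)|\le\max_K|f| \text{ for all } f\in\mathcal{O}(\Omega)\}$ be its holomorphically convex hull. Let $\Omega\Subset X$ be a relatively compact domain of holomorphy, i.e. a relatively compact subdomain such that there is no point $b\in\partial\Omega$ for which there are a connected open neighbourhood $U$ of $b$ in $X$ and a non-empty open subset $V\subset U\cap\Omega$ such that for every $h\in\mathcal{O}(\Omega)$ there is $g\in\mathcal{O}(U)$ with $h|_V=g|_V$. Let $K\subset\Omega$ be a compact subset. If $f\in\mathcal{O}(\Omega)$ satisfies $|f(a)|\le\rho(a,\Omega)$ for all $a\in K$, then $$|f(a)|\le\rho(a,\Omega)\qquad\text{for all } a\in\hat K_\Omega.$$ In particular, $\rho(K,\Omega)=\rho(\hat K_\Omega,\Omega)$. -/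

import Mathlib

open Set Metric Topology Bundle
open scoped Manifold ContDiff ENNReal

noncomputable section

namespace CartanThullen

/-- The model space `ℂⁿ`. Its norm is the maximum norm, so that `Metric.ball 0 r` is the
polydisk `r PΔ = {ζ : |ζʲ| < r for all j}` with centre `0`. -/
abbrev Cn (n : ℕ) : Type := Fin n → ℂ

/-- The holomorphic cotangent space of the complex manifold `X` at `x`. -/
abbrev Cotangent (n : ℕ) (X : Type*) [TopologicalSpace X] [ChartedSpace (Cn n) X] (x : X) : Type :=
  TangentSpace 𝓘(ℂ, Cn n) x →L[ℂ] Bundle.Trivial X ℂ x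

section Defs

variable {n : ℕ} {X : Type*} [TopologicalSpace X] [ChartedSpace (Cn n) X]

/-- The space `𝒪(Ω)` of holomorphic functions on the open set `Ω`
(only the values on `Ω` are meaningful). -/
def Hol (Ω : Set X) : Set (X → ℂ) :=
  {f | MDifferentiableOn 𝓘(ℂ, Cn n) 𝓘(ℂ, ℂ) f Ω}

/-- The expression of a `(1,0)`-form in the preferred chart at `p`: the pullback of `η` under the
inverse of this chart, as a differential form of degree one on the target of the chart. -/
def formInChart (η : ∀ x : X, Cotangent n X x) (p : X) (z : Cn n) : Cn n [⋀^Fin 1]→L[ℂ] ℂ :=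
  ContinuousAlternatingMap.ofSubsingleton ℂ (Cn n) ℂ (0 : Fin 1)
    ((η ((chartAt (Cn n) p).symm z)).comp
      (mfderiv 𝓘(ℂ, Cn n) 𝓘(ℂ, Cn n) (chartAt (Cn n) p).symm z))

/-- `dη = 0`, computed in the charts at all points of `X`. For a holomorphic `1`-form `η` one has
`dη = ∂η`, which is the complex exterior derivative of the coefficients. -/
def IsClosedForm (η : ∀ x : X, Cotangent n X x) : Prop :=
  ∀ p : X, ∀ z ∈ (chartAt (Cn n) p).target, extDeriv (formInChart η p) z = 0

/-- Condition A for `ω = (ω¹, …, ωⁿ)`: it is a global holomorphic frame of the holomorphic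
cotangent bundle over `X`, and `dωʲ = 0` for all `j`. -/
structure CondA [IsManifold 𝓘(ℂ, Cn n) ω X] (om : Fin n → ∀ x : X, Cotangent n X x) : Prop where
  frame : IsLocalFrameOn 𝓘(ℂ, Cn n) (Cn n →L[ℂ] ℂ) ω om univ
  closed : ∀ j, IsClosedForm (om j)

/-- `γ : [0, 1] → X` is a path of class `C¹` (for the underlying real structure) from `a` to `x`
which lies in `U`. -/
structure IsC1Path (U : Set X) (a x : X) (γ : ℝ → X) : Prop where
  contMDiffOn : ContMDiffOn 𝓘(ℝ, ℝ) 𝓘(ℝ, Cn n) 1 γ (Icc 0 1)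
  source : γ 0 = a
  target : γ 1 = x
  mapsTo : MapsTo γ (Icc 0 1) U

/-- The path integral `∫_γ η = ∫₀¹ η_{γ(t)}(γ'(t)) dt`. The real and the holomorphic tangent space
at a point are the same space `ℂⁿ` in the chart at that point. -/
def pathIntegral (η : ∀ x : X, Cotangent n X x) (γ : ℝ → X) : ℂ :=
  ∫ t in (0 : ℝ)..1, η (γ t) (mfderiv 𝓘(ℝ, ℝ) 𝓘(ℝ, Cn n) γ t (1 : ℝ))

/-- `φ` inverts on the polydisk `r₀ PΔ` the (single-valued branch on `U₀ = φ (r₀ PΔ)` of the)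
Abelian integral `x ↦ (∫_a^x ω¹, …, ∫_a^x ωⁿ)`: `U₀` is open, `φ 0 = a`, and for every `ζ ∈ r₀ PΔ`
the integral of `ωʲ` from `a` to `φ ζ` along any path in `U₀` is `ζʲ`. -/
structure IsLocalInverse (om : Fin n → ∀ x : X, Cotangent n X x) (a : X) (φ : Cn n → X) (r₀ : ℝ) :
    Prop where
  pos : 0 < r₀
  isOpen : IsOpen (φ '' ball 0 r₀)
  map_zero : φ 0 = a
  integral_eq : ∀ ζ ∈ ball (0 : Cn n) r₀, ∀ γ : ℝ → X,
    IsC1Path (n := n) (φ '' ball 0 r₀) a (φ ζ) γ → ∀ j, pathIntegral (om j) γ = ζ j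

/-- `φ` is a map `φ_{a,r}` from `r PΔ` to `X`: a holomorphic map on `r PΔ` which extends
analytically the inverse of the Abelian integral on some smaller polydisk `r₀ PΔ`. -/
def IsInverseExtension (om : Fin n → ∀ x : X, Cotangent n X x) (a : X) (r : ℝ) (φ : Cn n → X) :
    Prop :=
  MDifferentiableOn 𝓘(ℂ, Cn n) 𝓘(ℂ, Cn n) φ (ball 0 r) ∧ ∃ r₀ ≤ r, IsLocalInverse om a φ r₀

/-- The scalar `ρ(a, Ω) ∈ [0, ∞]`. -/
def rho (om : Fin n → ∀ x : X, Cotangent n X x) (a : X) (Ω : Set X) : ℝ≥0∞ :=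
  sSup {R | ∃ r : ℝ, 0 < r ∧ R = ENNReal.ofReal r ∧
    ∃ φ : Cn n → X, IsInverseExtension om a r φ ∧ MapsTo φ (ball 0 r) Ω}

/-- `ρ(A, Ω) = inf {ρ(a, Ω) : a ∈ A}`. -/
def rhoSet (om : Fin n → ∀ x : X, Cotangent n X x) (A : Set X) (Ω : Set X) : ℝ≥0∞ :=
  ⨅ a ∈ A, rho om a Ω

variable (n) in
/-- The holomorphically convex hull of `K` in `Ω`. -/
def holHull (K Ω : Set X) : Set X :=
  {x ∈ Ω | ∀ f ∈ Hol (n := n) Ω, ‖f x‖ₑ ≤ ⨆ y ∈ K, ‖f y‖ₑ}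

variable (n) in
/-- `Ω` is a domain of holomorphy: no boundary point `b` has a connected open neighbourhood `U`
with a nonempty open `V ⊆ U ∩ Ω` such that for every `f ∈ 𝒪(Ω)` the restriction `f|_V` is the
restriction of some `g ∈ 𝒪(U)`. -/
def IsDomainOfHolomorphy (Ω : Set X) : Prop :=
  IsOpen Ω ∧ IsConnected Ω ∧
    ¬ ∃ b ∈ frontier Ω, ∃ U V : Set X, IsOpen U ∧ IsConnected U ∧ b ∈ U ∧
      IsOpen V ∧ V.Nonempty ∧ V ⊆ U ∩ Ω ∧
      ∀ f ∈ Hol (n := n) Ω, ∃ g ∈ Hol (n := n) U, EqOn f g V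

end Defs

end CartanThullen

end

/-! Closed forms have local primitives, and because the `ωʲ` are a frame these primitives are local
coordinates (`CondA.exists_isDevChart`). Two such charts differ locally by a translation, so `X` has
a translation structure. The maps `φ_{a,r}` are exactly the maps on a polydisk, with value `a` at
`0`, that are locally a translation followed by the inverse of such a chart
(`IsInverseExtension.isDevAt`, `isInverseExtension_of_isDevAt`). For the same reason the directional
Taylor coefficients of `h ∈ 𝒪(Ω)` are globally defined holomorphic functions on `Ω`, just as partial
derivatives are on `ℂⁿ`.

The Cartan–Thullen argument then runs as in `ℂⁿ`. For `t < 1`, Cauchy's estimate and `|f| ≤ ρ` on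
`K` bound `|T_k(v)| (t|f|/r)^k` on `K`, uniformly in `k` and `‖v‖ ≤ r`, where `T_k(v)` is the `k`-th
coefficient in direction `v`. As `T_k(v) f^k` is holomorphic on `Ω`, the bound passes to the hull.
Hence for `a` in the hull and `r < |f(a)|` the Taylor series of every `h` at `a` converges on `r PΔ`
(`exists_holomorphic_extension`).

Suppose `ρ(a, Ω) < |f(a)|`. Relative compactness gives one `ε` by which every developing map into
`Ω` can be enlarged inside `X`, in particular beyond radius `ρ(a, Ω)` (`exists_extension`). If the
enlarged map left `Ω`, all `h` would continue across its first exit point on a segment from `0`,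
which a domain of holomorphy forbids (`mapsTo_of_isDomainOfHolomorphy`). So it stays in `Ω`, against
the definition of `ρ`. The equality of infima is the case of constant `f`. -/

noncomputable section

namespace CartanThullen

/-! ### Several complex variables: Cauchy estimates, Taylor coefficients, identity theorem. -/

section SeveralComplexVariables

variable {E F : Type*} [NormedAddCommGroup E] [NormedSpace ℂ E]
  [NormedAddCommGroup F] [NormedSpace ℂ F]

/-- Cauchy's estimate for the derivative of a holomorphic map on a normed space. -/
theorem norm_fderiv_le_of_ball {f : E → F} {z : E} {r C : ℝ} (hr : 0 < r)
    (hf : DifferentiableOn ℂ f (ball z r)) (hC : ∀ w ∈ ball z r, ‖f w‖ ≤ C) :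
    ‖fderiv ℂ f z‖ ≤ C / r := by
  have hC0 : 0 ≤ C := (norm_nonneg _).trans (hC z (mem_ball_self hr))
  have hfz : DifferentiableAt ℂ f z := hf.differentiableAt (ball_mem_nhds z hr)
  refine ContinuousLinearMap.opNorm_le_bound _ (by positivity) fun v => ?_
  rcases eq_or_ne v 0 with rfl | hv
  · simp
  have hv' : 0 < ‖v‖ := norm_pos_iff.2 hv
  -- One-variable Cauchy estimate on the disc `z + t • v`, `|t| ≤ s`, which lies in the open ball;
  -- the limiting radius `r / ‖v‖` is reached by letting `s` increase to it.
  have key : ∀ s, 0 < s → s < r / ‖v‖ → ‖fderiv ℂ f z v‖ ≤ C / s := by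
    intro s hs hsr
    have hmem : ∀ t : ℂ, ‖t‖ ≤ s → z + t • v ∈ ball z r := by
      intro t ht
      rw [mem_ball_iff_norm, add_sub_cancel_left, norm_smul]
      calc ‖t‖ * ‖v‖ ≤ s * ‖v‖ := by gcongr
        _ < r / ‖v‖ * ‖v‖ := by gcongr
        _ = r := by field_simp
    have hd : deriv (fun t : ℂ => f (z + t • v)) 0 = fderiv ℂ f z v := by
      have h1 : HasDerivAt (fun t : ℂ => z + t • v) v 0 := by
        simpa using ((hasDerivAt_id (0 : ℂ)).smul_const v).const_add z
      have h2 : HasFDerivAt f (fderiv ℂ f z) (z + (0 : ℂ) • v) := by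
        simpa using hfz.hasFDerivAt
      exact (h2.comp_hasDerivAt (0 : ℂ) h1).deriv
    rw [← hd]
    refine Complex.norm_deriv_le_of_forall_mem_sphere_norm_le hs ?_ ?_
    · apply DifferentiableOn.diffContOnCl
      rw [closure_ball _ hs.ne']
      refine hf.comp (by fun_prop) fun t ht => hmem t (by simpa using ht)
    · intro t ht
      exact hC _ (hmem t (by simpa using (mem_sphere_iff_norm.1 ht).le))
  have hlim : Filter.Tendsto (fun s : ℝ => C / s) (𝓝[<] (r / ‖v‖)) (𝓝 (C / (r / ‖v‖))) :=
    tendsto_nhdsWithin_of_tendsto_nhds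
      (tendsto_const_nhds.div Filter.tendsto_id (by positivity))
  have hev : ∀ᶠ s in 𝓝[<] (r / ‖v‖), ‖fderiv ℂ f z v‖ ≤ C / s := by
    filter_upwards [Ioo_mem_nhdsLT (show 0 < r / ‖v‖ by positivity)] with s hs
    exact key s hs.1 hs.2
  have := ge_of_tendsto hlim hev
  calc _ ≤ _ := this
    _ = C / r * ‖v‖ := by field_simp

/-- Cauchy's estimate is used twice: it makes `f` Lipschitz near `z`, and applied to `y ↦ f (y + (w
- z)) - f y`, which is then `O(‖w - z‖)`, it bounds the difference of the derivatives at `w` and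
`z`. The continuity serves differentiation under the integral sign. -/
theorem continuousOn_fderiv_of_differentiableOn {f : E → F} {O : Set E} (hO : IsOpen O)
    (hf : DifferentiableOn ℂ f O) : ContinuousOn (fderiv ℂ f) O := by
  intro z hz
  apply ContinuousAt.continuousWithinAt
  obtain ⟨δ, hδ, hball⟩ : ∃ δ > 0, ∀ w ∈ ball z δ, w ∈ O ∧ ‖f w‖ ≤ ‖f z‖ + 1 := by
    have h1 : ∀ᶠ w in 𝓝 z, ‖f w‖ < ‖f z‖ + 1 :=
      (hf.continuousOn.continuousAt (hO.mem_nhds hz)).norm.eventually_lt_const (by linarith)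
    obtain ⟨δ, hδ, h⟩ := Metric.eventually_nhds_iff_ball.1 (h1.and (hO.mem_nhds hz))
    exact ⟨δ, hδ, fun w hw => ⟨(h w hw).2, (h w hw).1.le⟩⟩
  have hdf : ∀ w ∈ ball z δ, DifferentiableAt ℂ f w := fun w hw =>
    hf.differentiableAt (hO.mem_nhds (hball w hw).1)
  have hbd : ∀ w ∈ ball z (δ / 2), ‖fderiv ℂ f w‖ ≤ (‖f z‖ + 1) / (δ / 2) := by
    intro w hw
    have hsub : ball w (δ / 2) ⊆ ball z δ := ball_subset_ball' (by
      have := mem_ball.1 hw; linarith)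
    exact norm_fderiv_le_of_ball (by positivity)
      (fun u hu => (hdf u (hsub hu)).differentiableWithinAt) fun u hu => (hball u (hsub hu)).2
  set L : ℝ := (‖f z‖ + 1) / (δ / 2) with hL
  have hlip : ∀ u ∈ ball z (δ / 2), ∀ w ∈ ball z (δ / 2), ‖f u - f w‖ ≤ L * ‖u - w‖ := by
    intro u hu w hw
    have hdiff : ∀ y ∈ ball z (δ / 2), DifferentiableAt ℂ f y := fun y hy =>
      hdf y (ball_subset_ball (by linarith) hy)
    let : NormedSpace ℝ E := NormedSpace.restrictScalars ℝ ℂ E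
    exact (convex_ball z (δ / 2)).norm_image_sub_le_of_norm_fderiv_le (𝕜 := ℂ)
      hdiff hbd hw hu
  have hmain : ∀ w ∈ ball z (δ / 4),
      ‖fderiv ℂ f w - fderiv ℂ f z‖ ≤ L * ‖w - z‖ / (δ / 4) := by
    intro w hw
    have hwz : dist w z < δ / 4 := hw
    have hsub : ∀ y ∈ ball z (δ / 4), y + (w - z) ∈ ball z (δ / 2) := by
      intro y hy
      rw [mem_ball_iff_norm] at hy hw ⊢
      calc ‖y + (w - z) - z‖ = ‖(y - z) + (w - z)‖ := by congr 1; abel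
        _ ≤ _ := norm_add_le _ _
        _ < _ := by linarith
    have hg : ∀ y ∈ ball z (δ / 4),
        HasFDerivAt (fun y => f (y + (w - z)) - f y) (fderiv ℂ f (y + (w - z)) - fderiv ℂ f y) y := by
      intro y hy
      have h1 : HasFDerivAt (fun y => f (y + (w - z))) (fderiv ℂ f (y + (w - z))) y :=
        (hasFDerivAt_comp_add_right (w - z)).2
          (hdf _ (ball_subset_ball (by linarith) (hsub y hy))).hasFDerivAt
      exact h1.sub (hdf y (ball_subset_ball (by linarith) hy)).hasFDerivAt
    have h0 := hg z (mem_ball_self (by positivity))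
    have := norm_fderiv_le_of_ball (f := fun y => f (y + (w - z)) - f y) (z := z)
      (r := δ / 4) (C := L * ‖w - z‖) (by positivity)
      (fun y hy => (hg y hy).differentiableAt.differentiableWithinAt) (fun y hy => by
        simpa using hlip _ (hsub y hy) y (ball_subset_ball (by linarith) hy))
    rw [h0.fderiv] at this
    simpa using this
  rw [ContinuousAt, tendsto_iff_norm_sub_tendsto_zero]
  refine squeeze_zero' (Filter.Eventually.of_forall fun _ => norm_nonneg _)
    (Filter.eventually_of_mem (ball_mem_nhds z (by positivity)) hmain) ?_
  have : Filter.Tendsto (fun w => L * ‖w - z‖ / (δ / 4)) (𝓝 z) (𝓝 (L * ‖z - z‖ / (δ / 4))) := by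
    apply Continuous.tendsto; fun_prop
  simpa using this

/-- A circle integral of holomorphic maps depending holomorphically on a parameter is
holomorphic. -/
theorem differentiableAt_circleIntegral [CompleteSpace F] {H : Type*} [NormedAddCommGroup H]
    [NormedSpace ℂ H] {f : E → F} {O : Set E} (hO : IsOpen O)
    (hf : DifferentiableOn ℂ f O) {z : H} {l : ℂ → H →L[ℂ] E} (hl : Continuous l) {c : ℂ → ℂ} {r : ℝ}
    (hr : 0 < r) (hc : ContinuousOn c (sphere 0 r))
    (hz : ∀ t ∈ sphere (0 : ℂ) r, l t z ∈ O) :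
    DifferentiableAt ℂ (fun w => ∮ t in C(0, r), c t • f (l t w)) z := by
  have hcomp : IsCompact ((fun t : ℂ => l t z) '' sphere 0 r) :=
    (isCompact_sphere 0 r).image (by fun_prop)
  have hcont := continuousOn_fderiv_of_differentiableOn hO hf
  have hK : (fun t : ℂ => l t z) '' sphere 0 r ⊆ O := by
    rintro _ ⟨t, ht, rfl⟩; exact hz t ht
  obtain ⟨M, hM⟩ := hcomp.exists_bound_of_continuousOn (hcont.mono hK)
  obtain ⟨A, hA⟩ := (isCompact_sphere (0 : ℂ) r).exists_bound_of_continuousOn hl.continuousOn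
  obtain ⟨B, hB⟩ := (isCompact_sphere (0 : ℂ) r).exists_bound_of_continuousOn hc
  have hcm : ∀ θ : ℝ, circleMap 0 r θ ∈ sphere (0 : ℂ) r := circleMap_mem_sphere 0 hr.le
  have hA0 : 0 ≤ A := (norm_nonneg _).trans (hA _ (hcm 0))
  obtain ⟨δ, hδ, hth⟩ : ∃ δ > 0, ∀ t ∈ sphere (0 : ℂ) r, ∀ w ∈ ball z δ,
      l t w ∈ O ∧ ‖fderiv ℂ f (l t w)‖ ≤ M + 1 := by
    have hopen : IsOpen (O ∩ (fun y => ‖fderiv ℂ f y‖) ⁻¹' Iio (M + 1)) :=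
      hcont.norm.isOpen_inter_preimage hO isOpen_Iio
    obtain ⟨δ, hδ, hsub⟩ := hcomp.exists_thickening_subset_open hopen
      (fun y hy => ⟨hK hy, (hM y hy).trans_lt (by simp)⟩)
    -- `A` bounds `‖l t‖` on the circle, so this radius moves `l t w` by less than `δ`; the `+ 1`
    -- covers `A = 0`.
    refine ⟨δ / (A + 1), by positivity, fun t ht w hw => ?_⟩
    have : l t w ∈ thickening δ ((fun t : ℂ => l t z) '' sphere 0 r) := by
      refine mem_thickening_iff.2 ⟨l t z, ⟨t, ht, rfl⟩, ?_⟩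
      rw [dist_eq_norm, ← map_sub]
      rw [mem_ball_iff_norm, lt_div_iff₀ (by positivity)] at hw
      calc ‖l t (w - z)‖ ≤ ‖l t‖ * ‖w - z‖ := (l t).le_opNorm _
        _ ≤ A * ‖w - z‖ := by gcongr; exact hA t ht
        _ < δ := by nlinarith [norm_nonneg (w - z)]
    exact ⟨(hsub this).1, le_of_lt (hsub this).2⟩
  have hcm' : Continuous fun θ : ℝ => circleMap (0 : ℂ) r θ := continuous_circleMap 0 r
  have hcc : Continuous fun θ : ℝ => c (circleMap 0 r θ) := hc.comp_continuous hcm' hcm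
  have hcd : Continuous fun θ : ℝ => deriv (circleMap 0 r) θ := by
    simp only [deriv_circleMap]; fun_prop
  have hint : ∀ w ∈ ball z δ, Continuous fun θ : ℝ =>
      deriv (circleMap 0 r) θ • c (circleMap 0 r θ) • f (l (circleMap 0 r θ) w) :=
    fun w hw => hcd.smul (hcc.smul
      (hf.continuousOn.comp_continuous (by fun_prop) fun θ => (hth _ (hcm θ) w hw).1))
  have hf'c : Continuous fun θ : ℝ => fderiv ℂ f (l (circleMap 0 r θ) z) :=
    hcont.comp_continuous (by fun_prop) fun θ => (hth _ (hcm θ) z (mem_ball_self hδ)).1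
  unfold circleIntegral
  refine HasFDerivAt.differentiableAt
    (intervalIntegral.hasFDerivAt_integral_of_dominated_of_fderiv_le
      (F := fun w θ => deriv (circleMap 0 r) θ • c (circleMap 0 r θ) •
        f (l (circleMap 0 r θ) w))
      (F' := fun w θ => deriv (circleMap 0 r) θ • c (circleMap 0 r θ) •
        (fderiv ℂ f (l (circleMap 0 r θ) w)).comp (l (circleMap 0 r θ)))
      (bound := fun _ => r * (B * ((M + 1) * A)))
      (ball_mem_nhds z hδ) ?_ ?_ ?_ ?_ ?_ ?_)
  · filter_upwards [ball_mem_nhds z hδ] with w hw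
    exact (hint w hw).aestronglyMeasurable
  · exact (hint z (mem_ball_self hδ)).intervalIntegrable _ _
  · exact (hcd.smul (hcc.smul (hf'c.clm_comp (hl.comp hcm')))).aestronglyMeasurable
  · refine Filter.Eventually.of_forall fun θ _ w hw => ?_
    have h1 := hB _ (hcm θ)
    have h2 := (hth _ (hcm θ) w hw).2
    have h4 := hA _ (hcm θ)
    rw [norm_smul, norm_smul]
    have h3 : ‖deriv (circleMap 0 r) θ‖ = r := by simp [abs_of_pos hr]
    have hB0 : 0 ≤ B := (norm_nonneg _).trans h1
    have hM0 : 0 ≤ M + 1 := (norm_nonneg _).trans h2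
    rw [h3]
    have h5 := ContinuousLinearMap.opNorm_comp_le (fderiv ℂ f (l (circleMap 0 r θ) w))
      (l (circleMap 0 r θ))
    have h6 : ‖fderiv ℂ f (l (circleMap 0 r θ) w)‖ * ‖l (circleMap 0 r θ)‖ ≤ (M + 1) * A := by
      gcongr
    gcongr
    exact h5.trans h6
  · exact intervalIntegrable_const
  · refine Filter.Eventually.of_forall fun θ _ w hw => ?_
    have h1 : HasFDerivAt (fun w => f (l (circleMap 0 r θ) w))
        ((fderiv ℂ f (l (circleMap 0 r θ) w)).comp (l (circleMap 0 r θ))) w :=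
      (hf.differentiableAt (hO.mem_nhds (hth _ (hcm θ) w hw).1)).hasFDerivAt.comp w
        (l (circleMap 0 r θ)).hasFDerivAt
    exact (h1.const_smul _).const_smul _

/-- The Taylor coefficients at `0` of `t ↦ f (z + t • v)` are holomorphic in `(z, v)`. -/
theorem differentiableOn_iteratedDeriv_line [CompleteSpace F] {f : E → F} {O : Set E}
    (hO : IsOpen O) (hf : DifferentiableOn ℂ f O) (k : ℕ) :
    DifferentiableOn ℂ (fun p : E × E => iteratedDeriv k (fun t : ℂ => f (p.1 + t • p.2)) 0)
      (O ×ˢ univ) := by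
  rintro ⟨z, v⟩ ⟨hz, -⟩
  apply DifferentiableAt.differentiableWithinAt
  let l : ℂ → E × E →L[ℂ] E := fun t => ContinuousLinearMap.fst ℂ E E +
    t • ContinuousLinearMap.snd ℂ E E
  have hl : Continuous l := by fun_prop
  have hlc : Continuous fun q : ℂ × (E × E) => q.2.1 + q.1 • q.2.2 := by fun_prop
  obtain ⟨r, hr, δ, hδ, hmem⟩ : ∃ r : ℝ, 0 < r ∧ ∃ δ > 0, ∀ p ∈ ball (z, v) δ, ∀ t : ℂ,
      ‖t‖ ≤ r → p.1 + t • p.2 ∈ O := by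
    have h1 : ∀ᶠ q : ℂ × (E × E) in 𝓝 (0, (z, v)), q.2.1 + q.1 • q.2.2 ∈ O :=
      hlc.continuousAt.eventually_mem (hO.mem_nhds (by simpa using hz))
    rw [nhds_prod_eq, Filter.eventually_prod_iff] at h1
    obtain ⟨p₁, h₁, p₂, h₂, h⟩ := h1
    obtain ⟨r, hr, h₁⟩ := Metric.eventually_nhds_iff_ball.1 h₁
    obtain ⟨δ, hδ, h₂⟩ := Metric.eventually_nhds_iff_ball.1 h₂
    refine ⟨r / 2, by positivity, δ, hδ, fun p hp t ht => h (h₁ t ?_) (h₂ p hp)⟩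
    rw [mem_ball_zero_iff]; linarith
  -- By Cauchy's formula the derivative is, up to a constant, a circle integral whose radius `r`
  -- works for all `(z, v)` nearby.
  have hD := differentiableAt_circleIntegral hO hf (z := (z, v)) hl
    (c := fun t => 1 / (t - 0) ^ (k + 1)) hr
    (continuousOn_const.div (by fun_prop) fun t ht => by
      have : ‖t‖ = r := by simpa using ht
      rw [sub_zero]
      exact pow_ne_zero _ (norm_pos_iff.1 (this ▸ hr)))
    (fun t ht => hmem _ (mem_ball_self hδ) t (by simpa using (mem_sphere_iff_norm.1 ht).le))
  refine (hD.const_smul ((2 * Real.pi * Complex.I / k.factorial : ℂ)⁻¹)).congr_of_eventuallyEq ?_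
  filter_upwards [ball_mem_nhds (z, v) hδ] with w hw
  have hg : DifferentiableOn ℂ (fun t : ℂ => f (w.1 + t • w.2)) (closedBall 0 r) :=
    hf.comp (by fun_prop) fun t ht => hmem w hw t (by simpa using ht)
  have h4 := (hg.mono closure_ball_subset_closedBall).diffContOnCl
    |>.circleIntegral_one_div_sub_center_pow_smul hr k
  have h5 : (2 * Real.pi * Complex.I / k.factorial : ℂ) ≠ 0 := by
    simp [Real.pi_ne_zero, Complex.I_ne_zero, k.factorial_ne_zero]
  simp only [l, Pi.smul_apply, add_apply, smul_apply,
    ContinuousLinearMap.coe_fst', ContinuousLinearMap.coe_snd']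
  rw [h4, inv_smul_smul₀ h5]

/-- The identity theorem on a convex open set. -/
theorem eqOn_zero_of_convex_of_eventuallyEq [CompleteSpace F] {f : E → F} {O : Set E}
    (hO : IsOpen O)
    (hconv : ∀ x ∈ O, ∀ y ∈ O, ∀ t : ℝ, t ∈ Icc (0 : ℝ) 1 → x + (t : ℂ) • (y - x) ∈ O)
    (hf : DifferentiableOn ℂ f O) {p : E} (hp : p ∈ O) (h0 : f =ᶠ[𝓝 p] 0) : EqOn f 0 O := by
  intro q hq
  let g : ℂ → E := fun t => p + t • (q - p)
  have hg : Continuous g := by fun_prop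
  have hS : IsOpen (g ⁻¹' O) := hO.preimage hg
  have han : AnalyticOnNhd ℂ (f ∘ g) (g ⁻¹' O) :=
    (hf.comp (Differentiable.differentiableOn (by fun_prop)) (mapsTo_preimage g O)).analyticOnNhd hS
  have hseg : IsPreconnected ((fun t : ℝ => (t : ℂ)) '' Icc (0 : ℝ) 1) :=
    isPreconnected_Icc.image _ (by fun_prop)
  have hsub : (fun t : ℝ => (t : ℂ)) '' Icc (0 : ℝ) 1 ⊆ g ⁻¹' O := by
    rintro _ ⟨t, ht, rfl⟩
    exact hconv p hp q hq t ht
  have hz : f ∘ g =ᶠ[𝓝 0] 0 := by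
    have : Filter.Tendsto g (𝓝 0) (𝓝 p) := by
      simpa [g] using hg.tendsto 0
    exact this.eventually h0
  have := (han.mono hsub).eqOn_zero_of_preconnected_of_eventuallyEq_zero hseg
    ⟨0, by simp, by simp⟩ hz
    (show (1 : ℂ) ∈ (fun t : ℝ => (t : ℂ)) '' Icc (0 : ℝ) 1 from ⟨1, by simp, by simp⟩)
  simpa [g] using this

/-- A series of holomorphic functions on a ball which is dominated by a convergent series is
holomorphic. -/
theorem differentiableOn_tsum_of_summable_norm_ball [CompleteSpace F] {f : ℕ → E → F} {u : ℕ → ℝ}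
    {z : E} {R : ℝ} (hu : Summable u) (hf : ∀ k, DifferentiableOn ℂ (f k) (ball z R))
    (hb : ∀ k, ∀ w ∈ ball z R, ‖f k w‖ ≤ u k) :
    DifferentiableOn ℂ (fun w => ∑' k, f k w) (ball z R) := by
  intro w hw
  apply DifferentiableAt.differentiableWithinAt
  obtain ⟨δ, hδ, hsub⟩ := Metric.isOpen_iff.1 isOpen_ball w hw
  let : NormedSpace ℝ E := NormedSpace.restrictScalars ℝ ℂ E
  have hsub' : ∀ y ∈ ball w (δ / 2), ball y (δ / 2) ⊆ ball z R := fun y hy =>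
    (ball_subset_ball' (by have := mem_ball.1 hy; linarith)).trans hsub
  refine (hasFDerivAt_tsum_of_isPreconnected (u := fun k => u k / (δ / 2))
    (f' := fun k y => fderiv ℂ (f k) y) (hu.div_const _)
    (isOpen_ball (x := w) (ε := δ / 2)) (convex_ball w (δ / 2)).isPreconnected
    (fun k y hy => ((hf k).differentiableAt (isOpen_ball.mem_nhds
      (hsub' y hy (mem_ball_self (by positivity))))).hasFDerivAt)
    (fun k y hy => norm_fderiv_le_of_ball (by positivity) ((hf k).mono (hsub' y hy))
      fun x hx => hb k x (hsub' y hy hx))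
    (mem_ball_self (by positivity)) ?_ (mem_ball_self (by positivity))).differentiableAt
  exact hu.of_norm_bounded fun k => hb k w hw

end SeveralComplexVariables

/-! ### Charts given by primitives of `ω`. -/

section DevelopingCharts

variable {n : ℕ} {X : Type*} [TopologicalSpace X] [ChartedSpace (Cn n) X]

/-- A developing chart of `ω`: a biholomorphic map `e` from an open subset of `X` to an open
subset of `ℂⁿ` with `deʲ = ωʲ`. -/
structure IsDevChart (om : Fin n → ∀ x : X, Cotangent n X x)
    (e : OpenPartialHomeomorph X (Cn n)) : Prop where
  contMDiffOn : ContMDiffOn 𝓘(ℂ, Cn n) 𝓘(ℂ, Cn n) 1 e e.source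
  contMDiffOn_symm : ContMDiffOn 𝓘(ℂ, Cn n) 𝓘(ℂ, Cn n) 1 e.symm e.target
  mfderiv_eq : ∀ x ∈ e.source, ∀ v : Cn n, ∀ j,
    (mfderiv 𝓘(ℂ, Cn n) 𝓘(ℂ, Cn n) e x v : Cn n) j = om j x v

/-- The coefficients of the form `η` in the chart at `p`. -/
def chartCoeff (η : ∀ x : X, Cotangent n X x) (p : X) (z : Cn n) : Cn n →L[ℂ] ℂ :=
  (η ((chartAt (Cn n) p).symm z)).comp
      (mfderiv 𝓘(ℂ, Cn n) 𝓘(ℂ, Cn n) (chartAt (Cn n) p).symm z)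

/-- The exterior derivative of a one-form on `(u, v)` is the antisymmetrized derivative of its
coefficients; this is the hypothesis of the Poincaré lemma. -/
theorem fderiv_chartCoeff_symm {η : ∀ x : X, Cotangent n X x} {p : X} {z : Cn n}
    (hd : DifferentiableAt ℂ (chartCoeff η p) z) (h : extDeriv (formInChart η p) z = 0)
    (u v : Cn n) : fderiv ℂ (chartCoeff η p) z u v = fderiv ℂ (chartCoeff η p) z v u := by
  have hT : formInChart η p = fun z =>
      ContinuousAlternatingMap.ofSubsingletonLIE (𝕜 := ℂ) (E := Cn n) (F := ℂ) (0 : Fin 1) (chartCoeff η p z) := rfl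
  have hdf : DifferentiableAt ℂ (formInChart η p) z := by
    rw [hT]; exact (LinearIsometryEquiv.differentiable _).differentiableAt.comp z hd
  have h1 := extDeriv_apply hdf ![u, v]
  rw [h] at h1
  have hap : ∀ w : Fin 1 → Cn n, (fun y => formInChart η p y w) = fun y => chartCoeff η p y (w 0) :=
    fun w => rfl
  have hfd : ∀ a b : Cn n, fderiv ℂ (fun y => chartCoeff η p y a) z b
      = fderiv ℂ (chartCoeff η p) z b a := fun a b => by
    rw [fderiv_clm_apply hd (differentiableAt_const a)]
    simp
  simp only [hap, hfd] at h1
  simp [Fin.removeNth] at h1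
  linear_combination -h1

variable [IsManifold 𝓘(ℂ, Cn n) ω X]

/-- In the trivialization at `p` a tangent vector is transported by the derivative of the inverse
chart, so near `p` the section `η` read there is `chartCoeff`. -/
theorem contDiffAt_chartCoeff {η : ∀ x : X, Cotangent n X x} (p : X)
    (h : ContMDiffAt 𝓘(ℂ, Cn n) (𝓘(ℂ, Cn n).prod 𝓘(ℂ, Cn n →L[ℂ] ℂ)) ω
      (fun x => TotalSpace.mk' (Cn n →L[ℂ] ℂ) (E := Cotangent n X) x (η x)) p) :
    ContDiffAt ℂ ω (chartCoeff η p) (chartAt (Cn n) p p) := by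
  have h2 := ((contMDiffAt_hom_bundle _).1 h).2
  have hs : ContMDiffAt 𝓘(ℂ, Cn n) 𝓘(ℂ, Cn n) ω (chartAt (Cn n) p).symm (chartAt (Cn n) p p) :=
    contMDiffOn_chart_symm.contMDiffAt
      ((chartAt (Cn n) p).open_target.mem_nhds (mem_chart_target _ p))
  have hp : (chartAt (Cn n) p).symm (chartAt (Cn n) p p) = p :=
    (chartAt (Cn n) p).left_inv (mem_chart_source _ p)
  have h3 := ContMDiffAt.comp (chartAt (Cn n) p p) (by rw [hp]; exact h2) hs
  refine (contMDiffAt_iff_contDiffAt.1 h3).congr_of_eventuallyEq ?_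
  filter_upwards [(chartAt (Cn n) p).open_target.mem_nhds (mem_chart_target _ p)] with z hz
  have hzs : (chartAt (Cn n) p).symm z ∈ (chartAt (Cn n) p).source :=
    (chartAt (Cn n) p).map_target hz
  simp only [Function.comp_apply, ContinuousLinearMap.inCoordinates]
  rw [TangentBundle.symmL_trivializationAt (I := 𝓘(ℂ, Cn n)) hzs]
  ext v
  simp [chartCoeff]
  have h4 : ∀ w, w = z → (η ((chartAt (Cn n) p).symm z) : Cn n →L[ℂ] ℂ)
      ((mfderiv 𝓘(ℂ, Cn n) 𝓘(ℂ, Cn n) (chartAt (Cn n) p).symm z : Cn n →L[ℂ] Cn n) v) =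
      (η ((chartAt (Cn n) p).symm z) : Cn n →L[ℂ] ℂ)
      ((mfderiv 𝓘(ℂ, Cn n) 𝓘(ℂ, Cn n) (chartAt (Cn n) p).symm w : Cn n →L[ℂ] Cn n) v) := by
    rintro w rfl; rfl
  exact h4 _ ((chartAt (Cn n) p).right_inv hz)

/-- At each point the frame `ω` separates tangent vectors. -/
theorem CondA.eq_zero_of_forall {om : Fin n → ∀ x : X, Cotangent n X x} (hom : CondA om) (x : X)
    (v : Cn n) (h : ∀ j, om j x v = 0) : v = 0 := by
  have h1 : ∀ l ∈ Submodule.span ℂ (range (om · x)), l v = 0 := by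
    intro l hl
    induction hl using Submodule.span_induction with
    | mem l hl => obtain ⟨j, rfl⟩ := hl; exact h j
    | zero => rfl
    | add l m _ _ hl hm =>
      change l v + m v = 0
      rw [hl, hm, add_zero]
    | smul c l _ hl =>
      change c • l v = 0
      rw [hl, smul_zero]
  ext i
  exact h1 (ContinuousLinearMap.proj (R := ℂ) (φ := fun _ : Fin n => ℂ) i)
    (hom.frame.generating (mem_univ x) trivial)

/-- Poincaré lemma on a ball in the chart at `p`. Regularity of the coefficients is known at the
centre only, but analyticity at a point is an open condition. -/
theorem CondA.exists_primitive {om : Fin n → ∀ x : X, Cotangent n X x} (hom : CondA om) (p : X) :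
    ∃ r > 0, ball (chartAt (Cn n) p p) r ⊆ (chartAt (Cn n) p).target ∧ ∃ α : Cn n → Cn n,
      (∀ z ∈ ball (chartAt (Cn n) p p) r, ContDiffAt ℂ 1 α z ∧
        HasFDerivAt α (ContinuousLinearMap.pi fun j => chartCoeff (om j) p z) z) := by
  have h1 : ∀ j, ContDiffAt ℂ ω (chartCoeff (om j) p) (chartAt (Cn n) p p) := fun j =>
    contDiffAt_chartCoeff p ((hom.frame.contMDiffOn j).contMDiffAt Filter.univ_mem)
  have h2 : ∀ᶠ z in 𝓝 (chartAt (Cn n) p p), z ∈ (chartAt (Cn n) p).target ∧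
      ∀ j, ContDiffAt ℂ ω (chartCoeff (om j) p) z :=
    ((chartAt (Cn n) p).open_target.eventually_mem (mem_chart_target _ p)).and
      (Filter.eventually_all.2 fun j => (h1 j).eventually (by simp))
  obtain ⟨r, hr, hb⟩ := Metric.eventually_nhds_iff_ball.1 h2
  refine ⟨r, hr, fun z hz => (hb z hz).1, ?_⟩
  have hdiff : ∀ j, ∀ z ∈ ball (chartAt (Cn n) p p) r,
      DifferentiableAt ℂ (chartCoeff (om j) p) z := fun j z hz =>
    ((hb z hz).2 j).differentiableAt (by simp)
  have h3 : ∀ j, ∃ f : Cn n → ℂ, ∀ z ∈ ball (chartAt (Cn n) p p) r,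
      HasFDerivAt f (chartCoeff (om j) p z) z := by
    intro j
    refine (convex_ball (chartAt (Cn n) p p) r).exists_forall_hasFDerivAt_of_fderiv_symmetric
      isOpen_ball (fun z hz => ((hdiff j z hz).restrictScalars ℝ).differentiableWithinAt) ?_
    intro z hz u v
    rw [(hdiff j z hz).fderiv_restrictScalars ℝ]
    exact fderiv_chartCoeff_symm (hdiff j z hz) (hom.closed j p z (hb z hz).1) u v
  choose f hf using h3
  have hα : ∀ z ∈ ball (chartAt (Cn n) p p) r, HasFDerivAt (fun z j => f j z)
      (ContinuousLinearMap.pi fun j => chartCoeff (om j) p z) z := fun z hz =>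
    hasFDerivAt_pi.2 fun j => hf j z hz
  refine ⟨fun z j => f j z, fun z hz => ⟨contDiffAt_pi.2 fun j => ?_, hα z hz⟩⟩
  exact contDiffAt_one_iff.2 ⟨_, ball (chartAt (Cn n) p p) r, isOpen_ball.mem_nhds hz,
    fun w hw => (hdiff j w hw).continuousAt.continuousWithinAt, hf j⟩

/-- Inverse function theorem: the derivative of the primitive `α` is the matrix of the frame, hence
invertible. -/
theorem CondA.exists_isDevChart {om : Fin n → ∀ x : X, Cotangent n X x} (hom : CondA om) (p : X) :
    ∃ e : OpenPartialHomeomorph X (Cn n), IsDevChart om e ∧ p ∈ e.source := by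
  obtain ⟨r, hr, hsub, α, hα⟩ := hom.exists_primitive p
  set c := chartAt (Cn n) p with hc
  have hcm : c ∈ IsManifold.maximalAtlas 𝓘(ℂ, Cn n) 1 X := IsManifold.chart_mem_maximalAtlas p
  have hcd : ∀ x ∈ c.source, MDifferentiableAt 𝓘(ℂ, Cn n) 𝓘(ℂ, Cn n) c x := fun x hx =>
    (contMDiffAt_of_mem_maximalAtlas hcm hx).mdifferentiableAt (by simp)
  have hcd' : ∀ z ∈ c.target, MDifferentiableAt 𝓘(ℂ, Cn n) 𝓘(ℂ, Cn n) c.symm z := fun x hx =>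
    (contMDiffAt_symm_of_mem_maximalAtlas hcm hx).mdifferentiableAt (by simp)
  have hc1 : ∀ z ∈ c.target, ∀ v : Cn n, mfderiv 𝓘(ℂ, Cn n) 𝓘(ℂ, Cn n) c (c.symm z)
      (mfderiv 𝓘(ℂ, Cn n) 𝓘(ℂ, Cn n) c.symm z v) = v := by
    intro z hz v
    have h := mfderiv_comp z (hcd _ (c.map_target hz)) (hcd' z hz)
    have h' : mfderiv 𝓘(ℂ, Cn n) 𝓘(ℂ, Cn n) (c ∘ c.symm) z = ContinuousLinearMap.id ℂ (Cn n) := by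
      rw [(show c ∘ c.symm =ᶠ[𝓝 z] id from c.eventually_right_inverse hz).mfderiv_eq]
      exact mfderiv_id
    rw [h'] at h
    exact (DFunLike.congr_fun h v).symm
  have hc2 : ∀ x ∈ c.source, ∀ v : Cn n, mfderiv 𝓘(ℂ, Cn n) 𝓘(ℂ, Cn n) c.symm (c x)
      (mfderiv 𝓘(ℂ, Cn n) 𝓘(ℂ, Cn n) c x v) = v := by
    intro x hx v
    have h := mfderiv_comp x (hcd' _ (c.map_source hx)) (hcd x hx)
    have h' : mfderiv 𝓘(ℂ, Cn n) 𝓘(ℂ, Cn n) (c.symm ∘ c) x = ContinuousLinearMap.id ℂ (Cn n) := by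
      rw [(show c.symm ∘ c =ᶠ[𝓝 x] id from c.eventually_left_inverse hx).mfderiv_eq]
      exact mfderiv_id
    rw [h'] at h
    exact (DFunLike.congr_fun h v).symm
  -- Invertibility is needed on the whole ball, not just at its centre, so that the local inverse is
  -- `C¹` on its entire domain.
  have hequiv : ∀ z ∈ ball (c p) r, ∃ A : Cn n ≃L[ℂ] Cn n, HasFDerivAt α (A : Cn n →L[ℂ] Cn n) z := by
    intro z hz
    have hinj : Function.Injective
        (ContinuousLinearMap.pi fun j => chartCoeff (om j) p z : Cn n →L[ℂ] Cn n) := by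
      rw [injective_iff_map_eq_zero]
      intro v hv
      have h1 := hom.eq_zero_of_forall (c.symm z) (mfderiv 𝓘(ℂ, Cn n) 𝓘(ℂ, Cn n) c.symm z v)
        (fun j => congrFun hv j)
      rw [← hc1 z (hsub hz) v]
      erw [h1]
      exact map_zero _
    let A := (LinearEquiv.ofInjectiveEndo _ hinj).toContinuousLinearEquiv
    exact ⟨A, (hα z hz).2⟩
  obtain ⟨A₀, hA₀⟩ := hequiv (c p) (mem_ball_self hr)
  let B₀ := (hα _ (mem_ball_self hr)).1.toOpenPartialHomeomorph α hA₀ one_ne_zero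
  have hB₀ : (B₀ : Cn n → Cn n) = α := rfl
  let B := B₀.restrOpen (ball (c p) r) isOpen_ball
  have hBs : B.source = B₀.source ∩ ball (c p) r := rfl
  have hB : (B : Cn n → Cn n) = α := rfl
  refine ⟨c.trans B, ⟨?_, ?_, ?_⟩, ?_⟩
  · rintro x ⟨hx, -, hxr⟩
    exact ((hα _ hxr).1.contMDiffAt.comp x
      (contMDiffAt_of_mem_maximalAtlas hcm hx)).contMDiffWithinAt
  · rintro w ⟨hw, hwc⟩
    obtain ⟨A, hA⟩ := hequiv _ (B.map_target hw).2
    have hBw : ContDiffAt ℂ 1 B.symm w := B.contDiffAt_symm hw hA (hα _ (B.map_target hw).2).1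
    exact ((contMDiffAt_symm_of_mem_maximalAtlas hcm hwc).comp w
      hBw.contMDiffAt).contMDiffWithinAt
  · rintro x ⟨hx, -, hxr⟩ v j
    have h1 : HasMFDerivAt 𝓘(ℂ, Cn n) 𝓘(ℂ, Cn n) (α ∘ c) x
        ((ContinuousLinearMap.pi fun j => chartCoeff (om j) p (c x) : Cn n →L[ℂ] Cn n).comp
          (mfderiv 𝓘(ℂ, Cn n) 𝓘(ℂ, Cn n) c x : Cn n →L[ℂ] Cn n)) :=
      (hα _ hxr).2.hasMFDerivAt.comp x (hcd x hx).hasMFDerivAt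
    have h2 : mfderiv 𝓘(ℂ, Cn n) 𝓘(ℂ, Cn n) (c.trans B) x = _ := h1.mfderiv
    rw [h2]
    have h3 : ∀ y, y = x → ∀ u : Cn n, u = v →
        (om j y : Cn n →L[ℂ] ℂ) u = (om j x : Cn n →L[ℂ] ℂ) v := by
      rintro y rfl u rfl; rfl
    exact h3 _ (c.left_inv hx) _ (hc2 x hx v)
  · exact ⟨mem_chart_source _ p, (hα _ (mem_ball_self hr)).1.mem_toOpenPartialHomeomorph_source hA₀
      one_ne_zero, mem_ball_self hr⟩

end DevelopingCharts

/-! ### Developing maps: rigidity and path integrals. -/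

section DevelopingMaps

variable {n : ℕ} {X : Type*} [TopologicalSpace X] [ChartedSpace (Cn n) X]

/-- `φ` is near `z` the composition of a translation with the inverse of a developing chart. -/
def IsDevAt (om : Fin n → ∀ x : X, Cotangent n X x) (φ : Cn n → X) (z : Cn n) : Prop :=
  ∃ e : OpenPartialHomeomorph X (Cn n), IsDevChart om e ∧ ∃ c : Cn n, c + z ∈ e.target ∧
    ∀ᶠ w in 𝓝 z, φ w = e.symm (c + w)

variable {om : Fin n → ∀ x : X, Cotangent n X x} {φ ψ : Cn n → X} {z : Cn n}

theorem IsDevAt.congr (h : IsDevAt om φ z) (h' : ψ =ᶠ[𝓝 z] φ) : IsDevAt om ψ z := by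
  obtain ⟨e, he, c, hc, h⟩ := h
  exact ⟨e, he, c, hc, by filter_upwards [h, h'] with w h1 h2; rw [h2, h1]⟩

theorem IsDevAt.eventually (h : IsDevAt om φ z) : ∀ᶠ w in 𝓝 z, IsDevAt om φ w := by
  obtain ⟨e, he, c, hc, h⟩ := h
  have h1 : ∀ᶠ w in 𝓝 z, c + w ∈ e.target :=
    (by fun_prop : Continuous fun w => c + w).continuousAt.eventually_mem (e.open_target.mem_nhds hc)
  filter_upwards [h1, h.eventually_nhds] with w h2 h3
  exact ⟨e, he, c, h2, h3⟩

theorem IsDevAt.comp_add {a : Cn n} (h : IsDevAt om φ (a + z)) :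
    IsDevAt om (fun w => φ (a + w)) z := by
  obtain ⟨e, he, c, hc, h⟩ := h
  refine ⟨e, he, c + a, by rwa [add_assoc], ?_⟩
  have : Filter.Tendsto (fun w => a + w) (𝓝 z) (𝓝 (a + z)) :=
    (by fun_prop : Continuous fun w => a + w).tendsto z
  filter_upwards [this.eventually h] with w hw
  rw [hw, add_assoc]

theorem IsDevChart.isDevAt {e : OpenPartialHomeomorph X (Cn n)} (he : IsDevChart om e) {c : Cn n}
    (h : c + z ∈ e.target) : IsDevAt om (fun w => e.symm (c + w)) z :=
  ⟨e, he, c, h, Filter.Eventually.of_forall fun _ => rfl⟩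

theorem IsDevAt.continuousAt (h : IsDevAt om φ z) : ContinuousAt φ z := by
  obtain ⟨e, he, c, hc, h⟩ := h
  refine ContinuousAt.congr ?_ (Filter.EventuallyEq.symm h)
  exact ContinuousAt.comp (f := fun w => c + w) (e.continuousAt_symm hc) (by fun_prop)

theorem IsDevAt.mdifferentiableAt (h : IsDevAt om φ z) :
    MDifferentiableAt 𝓘(ℂ, Cn n) 𝓘(ℂ, Cn n) φ z := by
  obtain ⟨e, he, c, hc, h⟩ := h
  refine MDifferentiableAt.congr_of_eventuallyEq ?_ h
  have h1 : MDifferentiableAt 𝓘(ℂ, Cn n) 𝓘(ℂ, Cn n) e.symm (c + z) :=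
    (he.contMDiffOn_symm.contMDiffAt (e.open_target.mem_nhds hc)).mdifferentiableAt (by simp)
  have h2 : MDifferentiableAt 𝓘(ℂ, Cn n) 𝓘(ℂ, Cn n) (fun w => c + w) z :=
    DifferentiableAt.mdifferentiableAt (by fun_prop)
  exact h1.comp z h2

theorem IsDevChart.mdifferentiableAt {e : OpenPartialHomeomorph X (Cn n)} (he : IsDevChart om e)
    {x : X} (hx : x ∈ e.source) : MDifferentiableAt 𝓘(ℂ, Cn n) 𝓘(ℂ, Cn n) e x :=
  (he.contMDiffOn.contMDiffAt (e.open_source.mem_nhds hx)).mdifferentiableAt (by simp)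

theorem IsDevChart.mdifferentiableAt_symm {e : OpenPartialHomeomorph X (Cn n)}
    (he : IsDevChart om e) {w : Cn n} (hw : w ∈ e.target) :
    MDifferentiableAt 𝓘(ℂ, Cn n) 𝓘(ℂ, Cn n) e.symm w :=
  (he.contMDiffOn_symm.contMDiffAt (e.open_target.mem_nhds hw)).mdifferentiableAt (by simp)

/-- The coordinate change between two developing charts has the derivative `1`. -/
theorem IsDevChart.hasFDerivAt_comp_symm {e e' : OpenPartialHomeomorph X (Cn n)}
    (he : IsDevChart om e) (he' : IsDevChart om e') {w : Cn n} (hw : w ∈ e.target)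
    (hw' : e.symm w ∈ e'.source) :
    HasFDerivAt (fun u => e' (e.symm u)) (ContinuousLinearMap.id ℂ (Cn n)) w := by
  have hs := (he.mdifferentiableAt_symm hw).hasMFDerivAt
  have key : ∀ e'' : OpenPartialHomeomorph X (Cn n), IsDevChart om e'' → e.symm w ∈ e''.source →
      ∃ L : Cn n →L[ℂ] Cn n, HasFDerivAt (fun u => e'' (e.symm u)) L w ∧
        ∀ v j, L v j = om j (e.symm w) (mfderiv 𝓘(ℂ, Cn n) 𝓘(ℂ, Cn n) e.symm w v) := by
    intro e'' he'' hw''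
    have h1 := ((he''.mdifferentiableAt hw'').hasMFDerivAt.comp w hs)
    exact ⟨_, h1.hasFDerivAt, fun v j => he''.mfderiv_eq _ hw'' _ j⟩
  obtain ⟨L, hL, hLv⟩ := key e he (e.map_target hw)
  obtain ⟨L', hL', hLv'⟩ := key e' he' hw'
  have hid : HasFDerivAt (fun u => e (e.symm u)) (ContinuousLinearMap.id ℂ (Cn n)) w :=
    (hasFDerivAt_id w).congr_of_eventuallyEq (e.eventually_right_inverse hw)
  have hLid : L = ContinuousLinearMap.id ℂ (Cn n) := hL.unique hid
  -- Both derivatives have the components `ωʲ` composed with the derivative of `e.symm`, and `L` is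
  -- the identity because `e ∘ e.symm` is.
  have : L' = L := by
    ext1 v; funext j; rw [hLv', hLv]
  rwa [this, hLid] at hL'

/-- A developing map is a translation in every developing chart. -/
theorem IsDevAt.eventually_eq (h : IsDevAt om φ z) {e : OpenPartialHomeomorph X (Cn n)}
    (he : IsDevChart om e) (hz : φ z ∈ e.source) :
    ∀ᶠ w in 𝓝 z, φ w ∈ e.source ∧ e (φ w) = e (φ z) + (w - z) := by
  have hs : ∀ᶠ w in 𝓝 z, φ w ∈ e.source := h.continuousAt.eventually_mem (e.open_source.mem_nhds hz)
  obtain ⟨e', he', c, hc, hev⟩ := h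
  have ht : ∀ᶠ w in 𝓝 z, c + w ∈ e'.target :=
    (by fun_prop : Continuous fun w => c + w).continuousAt.eventually_mem
      (e'.open_target.mem_nhds hc)
  obtain ⟨δ, hδ, hb⟩ := Metric.eventually_nhds_iff_ball.1 ((hs.and ht).and hev)
  filter_upwards [hs, ball_mem_nhds z hδ] with w hw hwb
  refine ⟨hw, ?_⟩
  -- The coordinate change minus the identity has derivative zero on a ball, hence is constant.
  have hd : ∀ u ∈ ball z δ, HasFDerivAt (fun u => e (e'.symm (c + u)) - u) (0 : Cn n →L[ℂ] Cn n) u := by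
    intro u hu
    have h1 := he'.hasFDerivAt_comp_symm he (hb u hu).1.2 ((hb u hu).2 ▸ (hb u hu).1.1)
    have h2 := (hasFDerivAt_comp_add_left (f := fun u => e (e'.symm u)) c).2 h1
    simpa using h2.sub (hasFDerivAt_id u)
  have hcst := (convex_ball z δ).is_const_of_fderivWithin_eq_zero (𝕜 := ℂ)
    (f := fun u => e (e'.symm (c + u)) - u)
    (fun u hu => (hd u hu).differentiableAt.differentiableWithinAt)
    (fun u hu => by rw [fderivWithin_of_isOpen isOpen_ball hu, (hd u hu).fderiv])
    hwb (mem_ball_self hδ)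
  simp only [← (hb w hwb).2, ← (hb z (mem_ball_self hδ)).2] at hcst
  rw [sub_eq_iff_eq_add] at hcst
  rw [hcst]; abel

theorem IsDevAt.eventuallyEq_of_eq [IsManifold 𝓘(ℂ, Cn n) ω X] (hom : CondA om)
    (h : IsDevAt om φ z) (h' : IsDevAt om ψ z) (hz : φ z = ψ z) : φ =ᶠ[𝓝 z] ψ := by
  obtain ⟨e, he, hx⟩ := hom.exists_isDevChart (φ z)
  filter_upwards [h.eventually_eq he hx, h'.eventually_eq he (hz ▸ hx)] with w h1 h2
  refine e.injOn h1.1 h2.1 ?_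
  rw [h1.2, h2.2, hz]

/-- Developing maps are determined by one value. -/
theorem eqOn_of_isDevAt [IsManifold 𝓘(ℂ, Cn n) ω X] [T2Space X] (hom : CondA om) {S : Set (Cn n)}
    (hS : IsPreconnected S) (h : ∀ w ∈ S, IsDevAt om φ w) (h' : ∀ w ∈ S, IsDevAt om ψ w)
    (hz : z ∈ S) (heq : φ z = ψ z) : EqOn φ ψ S := by
  -- Agreement of germs is open by definition. It is relatively closed because values agree in the
  -- limit (`X` is Hausdorff) and one value determines the germ.
  have hopen : IsOpen {w | φ =ᶠ[𝓝 w] ψ} := isOpen_iff_mem_nhds.2 fun w hw => by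
    exact Filter.Eventually.eventually_nhds hw
  have hsub := hS.subset_of_closure_inter_subset hopen
    ⟨z, hz, (h z hz).eventuallyEq_of_eq hom (h' z hz) heq⟩ (by
      rintro w ⟨hw, hwS⟩
      refine (h w hwS).eventuallyEq_of_eq hom (h' w hwS) ?_
      have hfr : ∃ᶠ u in 𝓝 w, φ u = ψ u :=
        (mem_closure_iff_frequently.1 hw).mono fun u hu => Filter.EventuallyEq.eq_of_nhds hu
      by_contra hne
      exact hfr (((h w hwS).continuousAt.prodMk (h' w hwS).continuousAt).eventually
        ((isClosed_diagonal (X := X)).isOpen_compl.mem_nhds hne)))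
  exact fun w hw => Filter.EventuallyEq.eq_of_nhds (hsub hw)

/-! ### Path integrals -/

theorem contMDiffWithinAt_restrictScalars {E : Type*} [NormedAddCommGroup E] [NormedSpace ℂ E]
    {E' : Type*} [NormedAddCommGroup E'] [NormedSpace ℂ E'] {M : Type*} [TopologicalSpace M]
    [ChartedSpace E M] {M' : Type*} [TopologicalSpace M'] [ChartedSpace E' M'] {f : M → M'}
    {s : Set M} {x : M} {k : ℕ∞ω} (h : ContMDiffWithinAt 𝓘(ℂ, E) 𝓘(ℂ, E') k f s x) :
    ContMDiffWithinAt 𝓘(ℝ, E) 𝓘(ℝ, E') k f s x := by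
  rw [contMDiffWithinAt_iff] at h ⊢
  exact ⟨h.1, h.2.restrict_scalars ℝ⟩

theorem hasMFDerivAt_restrictScalars {E : Type*} [NormedAddCommGroup E] [NormedSpace ℂ E]
    {E' : Type*} [NormedAddCommGroup E'] [NormedSpace ℂ E'] {M : Type*} [TopologicalSpace M]
    [ChartedSpace E M] {M' : Type*} [TopologicalSpace M'] [ChartedSpace E' M'] {f : M → M'}
    {x : M} {L : E →L[ℂ] E'} (h : HasMFDerivAt 𝓘(ℂ, E) 𝓘(ℂ, E') f x L) :
    HasMFDerivAt 𝓘(ℝ, E) 𝓘(ℝ, E') f x (L.restrictScalars ℝ) :=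
  ⟨h.1, HasFDerivWithinAt.restrictScalars ℝ h.2⟩

/-- The fundamental theorem of calculus for `ω` along a path in a developing chart. -/
theorem IsDevChart.pathIntegral_eq {e : OpenPartialHomeomorph X (Cn n)} (he : IsDevChart om e)
    {U : Set X} {a x : X} {γ : ℝ → X} (hγ : IsC1Path (n := n) U a x γ)
    (hmaps : MapsTo γ (Icc 0 1) e.source) (j : Fin n) :
    pathIntegral (om j) γ = e x j - e a j := by
  have h1 : ContMDiffOn 𝓘(ℝ, ℝ) 𝓘(ℝ, Cn n) 1 (e ∘ γ) (Icc 0 1) := fun t ht =>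
    (contMDiffWithinAt_restrictScalars (he.contMDiffOn _ (hmaps ht))).comp t
      (hγ.contMDiffOn t ht) hmaps
  have h2 : ContDiffOn ℝ 1 (fun t => e (γ t) j) (Icc 0 1) := contDiffOn_pi.1 h1.contDiffOn j
  have h3 : ∀ t ∈ Ioo (0 : ℝ) 1, HasDerivAt (fun t => e (γ t) j)
      (om j (γ t) (mfderiv 𝓘(ℝ, ℝ) 𝓘(ℝ, Cn n) γ t (1 : ℝ))) t := by
    intro t ht
    have hts := hmaps (Ioo_subset_Icc_self ht)
    have hγt : HasMFDerivAt 𝓘(ℝ, ℝ) 𝓘(ℝ, Cn n) γ t (mfderiv 𝓘(ℝ, ℝ) 𝓘(ℝ, Cn n) γ t) :=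
      ((hγ.contMDiffOn.contMDiffAt (Icc_mem_nhds ht.1 ht.2)).mdifferentiableAt
        (by simp)).hasMFDerivAt
    let L : Cn n →L[ℂ] Cn n := mfderiv 𝓘(ℂ, Cn n) 𝓘(ℂ, Cn n) e (γ t)
    let G : ℝ →L[ℝ] Cn n := mfderiv 𝓘(ℝ, ℝ) 𝓘(ℝ, Cn n) γ t
    have h4 : HasMFDerivAt 𝓘(ℝ, ℝ) 𝓘(ℝ, Cn n) (e ∘ γ) t ((L.restrictScalars ℝ).comp G) :=
      (hasMFDerivAt_restrictScalars (he.mdifferentiableAt hts).hasMFDerivAt).comp t hγt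
    have h5 : HasDerivAt (fun t => e (γ t)) (L (G 1)) t :=
      HasFDerivAt.hasDerivAt (f' := (L.restrictScalars ℝ).comp G) (hasMFDerivAt_iff_hasFDerivAt.1 h4)
    have h6 : HasDerivAt (fun t => e (γ t) j) (L (G 1) j) t := hasDerivAt_pi.1 h5 j
    rwa [show L (G 1) j = om j (γ t) (mfderiv 𝓘(ℝ, ℝ) 𝓘(ℝ, Cn n) γ t (1 : ℝ)) from
      he.mfderiv_eq _ hts _ j] at h6
  -- The two-sided derivative of `γ` may be a default value at the endpoints; on the open interval
  -- the integrand equals the one-sided derivative, which is continuous on `[0, 1]`.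
  have hint : IntervalIntegrable (fun t => om j (γ t) (mfderiv 𝓘(ℝ, ℝ) 𝓘(ℝ, Cn n) γ t (1 : ℝ)))
      MeasureTheory.volume 0 1 := by
    have h4 : ContinuousOn (derivWithin (fun t => e (γ t) j) (Icc 0 1)) (Icc 0 1) :=
      h2.continuousOn_derivWithin (uniqueDiffOn_Icc zero_lt_one) le_rfl
    refine (h4.intervalIntegrable_of_Icc zero_le_one).congr_uIoo ?_
    intro t ht
    rw [uIoo_of_le zero_le_one] at ht
    rw [derivWithin_of_mem_nhds (Icc_mem_nhds ht.1 ht.2), (h3 t ht).deriv]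
  have := intervalIntegral.integral_eq_sub_of_hasDerivAt_of_le zero_le_one h2.continuousOn h3 hint
  rw [pathIntegral, this, hγ.source, hγ.target]

end DevelopingMaps

/-! ### The maps `φ_{a,r}` are the developing maps with value `a` at `0`. -/

section InverseExtensions

variable {n : ℕ} {X : Type*} [TopologicalSpace X] [ChartedSpace (Cn n) X]
  {om : Fin n → ∀ x : X, Cotangent n X x} {φ : Cn n → X} {a : X} {r : ℝ}

theorem ofReal_smul_mem_ball {ζ : Cn n} (hζ : ζ ∈ ball (0 : Cn n) r) {t : ℝ}
    (ht : t ∈ Icc (0 : ℝ) 1) : (t : ℂ) • ζ ∈ ball (0 : Cn n) r := by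
  rw [mem_ball_zero_iff] at hζ ⊢
  rw [norm_smul, Complex.norm_real, Real.norm_of_nonneg ht.1]
  exact (mul_le_of_le_one_left (norm_nonneg _) ht.2).trans_lt hζ

/-- The image of a segment under a holomorphic map into a developing chart is a `C¹` path. -/
theorem IsDevChart.contMDiffOn_line {e : OpenPartialHomeomorph X (Cn n)} (he : IsDevChart om e)
    (hφ : ∀ z ∈ ball (0 : Cn n) r, MDifferentiableAt 𝓘(ℂ, Cn n) 𝓘(ℂ, Cn n) φ z ∧ φ z ∈ e.source)
    {ζ : Cn n} (hζ : ζ ∈ ball (0 : Cn n) r) :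
    ContMDiffOn 𝓘(ℝ, ℝ) 𝓘(ℝ, Cn n) 1 (fun t : ℝ => φ ((t : ℂ) • ζ)) (Icc 0 1) := by
  have hl : Continuous fun t : ℂ => t • ζ := by fun_prop
  have hD : IsOpen ((fun t : ℂ => t • ζ) ⁻¹' ball 0 r) := isOpen_ball.preimage hl
  have hmem : ∀ t ∈ Icc (0 : ℝ) 1, (t : ℂ) ∈ (fun t : ℂ => t • ζ) ⁻¹' ball 0 r := fun t ht =>
    ofReal_smul_mem_ball hζ ht
  have h1 : DifferentiableOn ℂ (fun t : ℂ => e (φ (t • ζ))) ((fun t : ℂ => t • ζ) ⁻¹' ball 0 r) := by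
    intro t ht
    have h2 : MDifferentiableAt 𝓘(ℂ, Cn n) 𝓘(ℂ, Cn n) (e ∘ φ) (t • ζ) :=
      (he.mdifferentiableAt (hφ _ ht).2).comp _ (hφ _ ht).1
    have h3 : DifferentiableAt ℂ (fun z => e (φ z)) (t • ζ) := h2.differentiableAt
    exact (DifferentiableAt.comp (f := fun t : ℂ => t • ζ) t h3
      (by fun_prop)).differentiableWithinAt
  have h2 : ContDiffOn ℝ 1 (fun t : ℝ => e (φ ((t : ℂ) • ζ))) (Icc 0 1) :=
    ((h1.contDiffOn hD).restrict_scalars ℝ).comp Complex.ofRealCLM.contDiff.contDiffOn hmem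
  have h3 : ContMDiffOn 𝓘(ℝ, ℝ) 𝓘(ℝ, Cn n) 1 (e.symm ∘ fun t : ℝ => e (φ ((t : ℂ) • ζ))) (Icc 0 1) :=
    ContMDiffOn.comp (t := e.target)
      (fun w hw => contMDiffWithinAt_restrictScalars (he.contMDiffOn_symm w hw)) h2.contMDiffOn
      fun t ht => e.map_source (hφ _ (hmem t ht)).2
  exact h3.congr fun t ht => (e.left_inv (hφ _ (hmem t ht)).2).symm

/-- Integrating along the image of the segment from `0` to `ζ` gives `e (φ ζ) - e a = ζ` in a
developing chart `e` at `a`. -/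
theorem IsInverseExtension.isDevAt_zero [IsManifold 𝓘(ℂ, Cn n) ω X] (hom : CondA om)
    (h : IsInverseExtension om a r φ) : IsDevAt om φ 0 := by
  obtain ⟨hd, r₀, hr₀, hinv⟩ := h
  obtain ⟨e, he, hx⟩ := hom.exists_isDevChart a
  have h0 : (0 : Cn n) ∈ ball (0 : Cn n) r₀ := mem_ball_self hinv.pos
  have hdat : ∀ z ∈ ball (0 : Cn n) r, MDifferentiableAt 𝓘(ℂ, Cn n) 𝓘(ℂ, Cn n) φ z := fun z hz =>
    (hd z hz).mdifferentiableAt (isOpen_ball.mem_nhds hz)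
  have hev : ∀ᶠ z in 𝓝 (0 : Cn n), φ z ∈ e.source ∧ z ∈ ball (0 : Cn n) r₀ :=
    ((hdat 0 (ball_subset_ball hr₀ h0)).continuousAt.eventually_mem
      (e.open_source.mem_nhds (by rwa [hinv.map_zero]))).and (isOpen_ball.mem_nhds h0)
  obtain ⟨δ, hδ, hb⟩ := Metric.eventually_nhds_iff_ball.1 hev
  refine ⟨e, he, e a, by simpa using e.map_source hx, ?_⟩
  filter_upwards [ball_mem_nhds (0 : Cn n) hδ] with ζ hζ
  have hseg : ∀ t ∈ Icc (0 : ℝ) 1, (t : ℂ) • ζ ∈ ball (0 : Cn n) δ := fun t ht =>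
    ofReal_smul_mem_ball hζ ht
  have hγ : IsC1Path (n := n) (φ '' ball 0 r₀) a (φ ζ) (fun t : ℝ => φ ((t : ℂ) • ζ)) :=
    { contMDiffOn := he.contMDiffOn_line (fun z hz =>
        ⟨hdat z (ball_subset_ball hr₀ (hb z hz).2), (hb z hz).1⟩) hζ
      source := by simpa using hinv.map_zero
      target := by simp
      mapsTo := fun t ht => ⟨_, (hb _ (hseg t ht)).2, rfl⟩ }
  have hζe : e (φ ζ) = e a + ζ := by
    funext j
    have h1 := he.pathIntegral_eq hγ (fun t ht => (hb _ (hseg t ht)).1) j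
    rw [hinv.integral_eq ζ (hb ζ hζ).2 _ hγ j] at h1
    rw [Pi.add_apply, h1]; ring
  rw [← hζe, e.left_inv (hb ζ hζ).1]

/-- Being a translation in a developing chart propagates from `0` over the polydisk by the identity
theorem: the set where it holds is open and relatively closed. -/
theorem IsInverseExtension.isDevAt [IsManifold 𝓘(ℂ, Cn n) ω X] (hom : CondA om)
    (h : IsInverseExtension om a r φ) : ∀ z ∈ ball (0 : Cn n) r, IsDevAt om φ z := by
  have h0 := h.isDevAt_zero hom
  obtain ⟨hd, r₀, hr₀, hinv⟩ := h
  have hdat : ∀ z ∈ ball (0 : Cn n) r, MDifferentiableAt 𝓘(ℂ, Cn n) 𝓘(ℂ, Cn n) φ z := fun z hz =>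
    (hd z hz).mdifferentiableAt (isOpen_ball.mem_nhds hz)
  have hopen : IsOpen {z | IsDevAt om φ z} := isOpen_iff_mem_nhds.2 fun z hz => IsDevAt.eventually hz
  refine (convex_ball (0 : Cn n) r).isPreconnected.subset_of_closure_inter_subset hopen
    ⟨0, mem_ball_self (hinv.pos.trans_le hr₀), h0⟩ ?_
  rintro z ⟨hzc, hz⟩
  obtain ⟨e, he, hx⟩ := hom.exists_isDevChart (φ z)
  have hev : ∀ᶠ w in 𝓝 z, φ w ∈ e.source ∧ w ∈ ball (0 : Cn n) r :=
    ((hdat z hz).continuousAt.eventually_mem (e.open_source.mem_nhds hx)).and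
      (isOpen_ball.mem_nhds hz)
  obtain ⟨δ, hδ, hb⟩ := Metric.eventually_nhds_iff_ball.1 hev
  obtain ⟨p, hpb, hp⟩ := mem_closure_iff.1 hzc _ isOpen_ball (mem_ball_self hδ)
  have hF : DifferentiableOn ℂ (fun w => e (φ w) - (e (φ p) + (w - p))) (ball z δ) := by
    intro w hw
    have h2 : MDifferentiableAt 𝓘(ℂ, Cn n) 𝓘(ℂ, Cn n) (e ∘ φ) w :=
      (he.mdifferentiableAt (hb w hw).1).comp _ (hdat w (hb w hw).2)
    have h3 : DifferentiableAt ℂ (fun w => e (φ w)) w := h2.differentiableAt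
    exact (h3.sub (by fun_prop)).differentiableWithinAt
  have hzero := eqOn_zero_of_convex_of_eventuallyEq isOpen_ball (fun x hx y hy t ht => by
      have := (convex_ball z δ).add_smul_sub_mem hx hy ht
      simpa using this) hF hpb (by
      filter_upwards [IsDevAt.eventually_eq hp he (hb p hpb).1] with w hw
      rw [hw.2]; simp)
  have heq : ∀ w ∈ ball z δ, e (φ w) = (e (φ p) - p) + w := by
    intro w hw
    have := hzero hw
    simp only [Pi.zero_apply] at this
    rw [sub_eq_zero] at this
    rw [this]; abel
  refine ⟨e, he, e (φ p) - p, ?_, ?_⟩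
  · rw [← heq z (mem_ball_self hδ)]; exact e.map_source hx
  · filter_upwards [ball_mem_nhds z hδ] with w hw
    rw [← heq w hw, e.left_inv (hb w hw).1]

/-- On a small polydisk `φ` is a translate of a single `e.symm`, so every path in its image stays in
`e.source`, where `e` integrates the forms. -/
theorem isInverseExtension_of_isDevAt (hr : 0 < r) (h0 : φ 0 = a)
    (h : ∀ z ∈ ball (0 : Cn n) r, IsDevAt om φ z) : IsInverseExtension om a r φ := by
  refine ⟨fun z hz => (h z hz).mdifferentiableAt.mdifferentiableWithinAt, ?_⟩
  obtain ⟨e, he, c, hc, hev⟩ := h 0 (mem_ball_self hr)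
  have ht : ∀ᶠ w in 𝓝 (0 : Cn n), c + w ∈ e.target :=
    (by fun_prop : Continuous fun w => c + w).continuousAt.eventually_mem
      (e.open_target.mem_nhds hc)
  obtain ⟨δ, hδ, hb⟩ := Metric.eventually_nhds_iff_ball.1 (hev.and ht)
  have hb' : ∀ w ∈ ball (0 : Cn n) (min r δ), φ w = e.symm (c + w) ∧ c + w ∈ e.target :=
    fun w hw => hb w (ball_subset_ball (min_le_right _ _) hw)
  have hpos : 0 < min r δ := lt_min hr hδ
  refine ⟨min r δ, min_le_left _ _, hpos, ?_, h0, ?_⟩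
  · have himage : φ '' ball 0 (min r δ) = e.symm '' ball c (min r δ) := by
      ext x
      constructor
      · rintro ⟨w, hw, rfl⟩
        exact ⟨c + w, by simpa using hw, (hb' w hw).1.symm⟩
      · rintro ⟨u, hu, rfl⟩
        have hw : u - c ∈ ball (0 : Cn n) (min r δ) := by
          rw [mem_ball_zero_iff]; rwa [mem_ball_iff_norm] at hu
        exact ⟨u - c, hw, by rw [(hb' _ hw).1]; congr 1; abel⟩
    rw [himage]
    refine e.symm.isOpen_image_of_subset_source isOpen_ball fun u hu => ?_
    have hw : u - c ∈ ball (0 : Cn n) (min r δ) := by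
      rw [mem_ball_zero_iff]; rwa [mem_ball_iff_norm] at hu
    simpa using (hb' _ hw).2
  · intro ζ hζ γ hγ j
    have hmaps : MapsTo γ (Icc 0 1) e.source := fun t ht => by
      obtain ⟨w, hw, hwt⟩ := hγ.mapsTo ht
      rw [← hwt, (hb' w hw).1]
      exact e.map_target (hb' w hw).2
    rw [he.pathIntegral_eq hγ hmaps j, ← h0, (hb' ζ hζ).1, (hb' 0 (mem_ball_self hpos)).1,
      e.right_inv (hb' ζ hζ).2, e.right_inv (hb' 0 (mem_ball_self hpos)).2]
    simp

/-- The scalar `ρ(a, Ω)` in terms of developing maps. -/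
theorem lt_rho_iff [IsManifold 𝓘(ℂ, Cn n) ω X] (hom : CondA om) {Ω : Set X} {R : ℝ≥0∞} :
    R < rho om a Ω ↔ ∃ r : ℝ, 0 < r ∧ R < ENNReal.ofReal r ∧ ∃ φ : Cn n → X, φ 0 = a ∧
      (∀ z ∈ ball (0 : Cn n) r, IsDevAt om φ z) ∧ MapsTo φ (ball 0 r) Ω := by
  rw [rho, lt_sSup_iff]
  constructor
  · rintro ⟨_, ⟨r, hr, rfl, φ, hφ, hm⟩, hlt⟩
    obtain ⟨r₀, -, hinv⟩ := hφ.2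
    exact ⟨r, hr, hlt, φ, hinv.map_zero, hφ.isDevAt hom, hm⟩
  · rintro ⟨r, hr, hlt, φ, h0, hφ, hm⟩
    exact ⟨_, ⟨r, hr, rfl, φ, isInverseExtension_of_isDevAt hr h0 hφ, hm⟩, hlt⟩

theorem le_rho {Ω : Set X} (hr : 0 < r) (h0 : φ 0 = a)
    (h : ∀ z ∈ ball (0 : Cn n) r, IsDevAt om φ z) (hm : MapsTo φ (ball 0 r) Ω) :
    ENNReal.ofReal r ≤ rho om a Ω :=
  le_sSup ⟨r, hr, rfl, φ, isInverseExtension_of_isDevAt hr h0 h, hm⟩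

end InverseExtensions

/-! ### Taylor coefficients as holomorphic functions on `Ω`. -/

section TaylorCoefficients

variable {n : ℕ} {X : Type*} [TopologicalSpace X] [ChartedSpace (Cn n) X]
  {om : Fin n → ∀ x : X, Cotangent n X x} {φ : Cn n → X} {a : X}
  {r : ℝ} {Ω : Set X} {h : X → ℂ}

theorem subset_holHull {K : Set X} (hKΩ : K ⊆ Ω) : K ⊆ holHull n K Ω := fun x hx =>
  ⟨hKΩ hx, fun f _ => le_iSup₂ (f := fun y (_ : y ∈ K) => ‖f y‖ₑ) x hx⟩

theorem Hol.continuousOn (hh : h ∈ Hol (n := n) Ω) : ContinuousOn h Ω := fun x hx =>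
  (hh x hx).continuousWithinAt

theorem IsDevAt.differentiableAt_comp {z : Cn n} (hφ : IsDevAt om φ z) (hΩ : IsOpen Ω) (hh : h ∈ Hol (n := n) Ω)
    (hm : φ z ∈ Ω) : DifferentiableAt ℂ (fun w => h (φ w)) z := by
  have h1 : MDifferentiableAt 𝓘(ℂ, Cn n) 𝓘(ℂ, ℂ) h (φ z) :=
    (hh _ hm).mdifferentiableAt (hΩ.mem_nhds hm)
  exact (h1.comp z hφ.mdifferentiableAt).differentiableAt

theorem IsDevChart.differentiableOn_comp_symm {e : OpenPartialHomeomorph X (Cn n)}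
    (he : IsDevChart om e) (hΩ : IsOpen Ω) (hh : h ∈ Hol (n := n) Ω) :
    DifferentiableOn ℂ (fun w => h (e.symm w)) (e.target ∩ e.symm ⁻¹' Ω) := by
  rintro w ⟨hw, hwΩ⟩
  have h1 : MDifferentiableAt 𝓘(ℂ, Cn n) 𝓘(ℂ, ℂ) h (e.symm w) :=
    (hh _ hwΩ).mdifferentiableAt (hΩ.mem_nhds hwΩ)
  exact (h1.comp w (he.mdifferentiableAt_symm hw)).differentiableAt.differentiableWithinAt

variable [IsManifold 𝓘(ℂ, Cn n) ω X]

/-- The `k`-th Taylor coefficient at `x` of `h` in the direction `v`, with respect to the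
coordinates given by the developing charts. -/
def taylorCoeff (hom : CondA om) (h : X → ℂ) (k : ℕ) (v : Cn n) (x : X) : ℂ :=
  (k.factorial : ℂ)⁻¹ * iteratedDeriv k (fun t : ℂ =>
    h ((hom.exists_isDevChart x).choose.symm ((hom.exists_isDevChart x).choose x + t • v))) 0

/-- The chosen chart does not matter: a developing map read in it is a translation, which carries
the line through `z` in direction `v` to one in the same direction. -/
theorem taylorCoeff_eq (hom : CondA om) (h : X → ℂ) (k : ℕ) (v : Cn n) {z : Cn n}
    (hφ : IsDevAt om φ z) : taylorCoeff hom h k v (φ z) =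
      (k.factorial : ℂ)⁻¹ * iteratedDeriv k (fun t : ℂ => h (φ (z + t • v))) 0 := by
  obtain ⟨he, hx⟩ := (hom.exists_isDevChart (φ z)).choose_spec
  rw [taylorCoeff]
  set e := (hom.exists_isDevChart (φ z)).choose
  congr 1
  apply Filter.EventuallyEq.iteratedDeriv_eq
  have hl : Filter.Tendsto (fun t : ℂ => z + t • v) (𝓝 0) (𝓝 z) := by
    have : Continuous fun t : ℂ => z + t • v := by fun_prop
    simpa using this.tendsto 0
  filter_upwards [hl.eventually (hφ.eventually_eq he hx)] with t ht
  rw [← e.left_inv ht.1, ht.2]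
  simp

theorem IsDevChart.taylorCoeff_eq {e : OpenPartialHomeomorph X (Cn n)} (he : IsDevChart om e)
    (hom : CondA om) (h : X → ℂ) (k : ℕ) (v : Cn n) {x : X} (hx : x ∈ e.source) :
    taylorCoeff hom h k v x =
      (k.factorial : ℂ)⁻¹ * iteratedDeriv k (fun t : ℂ => h (e.symm (e x + t • v))) 0 := by
  have h1 := CartanThullen.taylorCoeff_eq hom h k v (he.isDevAt (c := e x) (z := 0)
    (by simpa using e.map_source hx))
  simpa [e.left_inv hx] using h1

/-- The Taylor coefficients of a holomorphic function are holomorphic functions. -/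
theorem taylorCoeff_mem_hol (hom : CondA om) (hΩ : IsOpen Ω) (hh : h ∈ Hol (n := n) Ω) (k : ℕ)
    (v : Cn n) : taylorCoeff hom h k v ∈ Hol (n := n) Ω := by
  intro x hx
  apply MDifferentiableAt.mdifferentiableWithinAt
  obtain ⟨e, he, hxe⟩ := hom.exists_isDevChart x
  have hO : IsOpen (e.target ∩ e.symm ⁻¹' Ω) := e.symm.isOpen_inter_preimage hΩ
  have hd := differentiableOn_iteratedDeriv_line hO (he.differentiableOn_comp_symm hΩ hh) k
  have h1 : DifferentiableAt ℂ (fun w : Cn n => (k.factorial : ℂ)⁻¹ *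
      iteratedDeriv k (fun t : ℂ => h (e.symm (w + t • v))) 0) (e x) := by
    have h2 := (hd (e x, v) ⟨⟨e.map_source hxe, by simpa [e.left_inv hxe] using hx⟩,
      trivial⟩).differentiableAt ((hO.prod isOpen_univ).mem_nhds
        ⟨⟨e.map_source hxe, by simpa [e.left_inv hxe] using hx⟩, trivial⟩)
    exact (DifferentiableAt.comp (f := fun w : Cn n => (w, v)) (e x) h2 (by fun_prop)).const_mul _
  refine (h1.mdifferentiableAt.comp x (he.mdifferentiableAt hxe)).congr_of_eventuallyEq ?_
  filter_upwards [e.open_source.mem_nhds hxe] with y hy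
  exact he.taylorCoeff_eq hom h k v hy

/-- The Taylor coefficients at a point are holomorphic in the direction. -/
theorem differentiable_taylorCoeff (hom : CondA om) (hΩ : IsOpen Ω) (hh : h ∈ Hol (n := n) Ω)
    (k : ℕ) {x : X} (hx : x ∈ Ω) : Differentiable ℂ (fun v => taylorCoeff hom h k v x) := by
  intro v
  obtain ⟨e, he, hxe⟩ := hom.exists_isDevChart x
  have hO : IsOpen (e.target ∩ e.symm ⁻¹' Ω) := e.symm.isOpen_inter_preimage hΩ
  have hmem : (e x, v) ∈ (e.target ∩ e.symm ⁻¹' Ω) ×ˢ (univ : Set (Cn n)) :=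
    ⟨⟨e.map_source hxe, by simpa [e.left_inv hxe] using hx⟩, trivial⟩
  have hd := (differentiableOn_iteratedDeriv_line hO (he.differentiableOn_comp_symm hΩ hh) k
    (e x, v) hmem).differentiableAt ((hO.prod isOpen_univ).mem_nhds hmem)
  simp only [he.taylorCoeff_eq hom h k _ hxe]
  exact (DifferentiableAt.comp (f := fun v : Cn n => (e x, v)) v hd (by fun_prop)).const_mul _

/-- Cauchy's estimate for the Taylor coefficients. -/
theorem norm_taylorCoeff_mul_pow_le (hom : CondA om) (hΩ : IsOpen Ω) (hh : h ∈ Hol (n := n) Ω)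
    (k : ℕ) {v z : Cn n} {q M : ℝ} (hq : 0 < q)
    (hφ : ∀ t : ℂ, ‖t‖ ≤ q → IsDevAt om φ (z + t • v) ∧ φ (z + t • v) ∈ Ω ∧
      ‖h (φ (z + t • v))‖ ≤ M) : ‖taylorCoeff hom h k v (φ z)‖ * q ^ k ≤ M := by
  have hz : IsDevAt om φ z := by simpa using (hφ 0 (by simpa using hq.le)).1
  rw [taylorCoeff_eq hom h k v hz]
  have hd : DifferentiableOn ℂ (fun t : ℂ => h (φ (z + t • v))) (closedBall 0 q) := by
    intro t ht
    obtain ⟨h1, h2, -⟩ := hφ t (by simpa using ht)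
    exact (DifferentiableAt.comp (f := fun t : ℂ => z + t • v) t
      (h1.differentiableAt_comp hΩ hh h2) (by fun_prop)).differentiableWithinAt
  have h1 := Complex.norm_iteratedDeriv_le_of_forall_mem_sphere_norm_le k hq
    (hd.mono closure_ball_subset_closedBall).diffContOnCl
    (fun t ht => (hφ t (by simpa using (mem_sphere_iff_norm.1 ht).le)).2.2)
  have hk : (0 : ℝ) < k.factorial := by positivity
  rw [norm_mul, norm_inv, Complex.norm_natCast]
  calc (k.factorial : ℝ)⁻¹ * ‖iteratedDeriv k (fun t : ℂ => h (φ (z + t • v))) 0‖ * q ^ k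
      ≤ (k.factorial : ℝ)⁻¹ * (k.factorial * M / q ^ k) * q ^ k := by gcongr
    _ = M := by field_simp

/-- Taylor expansion along a developing map. -/
theorem hasSum_taylorCoeff (hom : CondA om) (hΩ : IsOpen Ω) (hh : h ∈ Hol (n := n) Ω)
    (hφ : ∀ z ∈ ball (0 : Cn n) r, IsDevAt om φ z) (hm : MapsTo φ (ball 0 r) Ω) {ζ : Cn n}
    (hζ : ζ ∈ ball (0 : Cn n) r) :
    HasSum (fun k => taylorCoeff hom h k ζ (φ 0)) (h (φ ζ)) := by
  have hr : 0 < r := pos_of_mem_ball hζ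
  rw [mem_ball_zero_iff] at hζ
  -- With `s > 1` the function `t ↦ h (φ (t • ζ))` is holomorphic on a disc containing `t = 1`,
  -- where its Taylor series is evaluated.
  obtain ⟨s, hs1, hs⟩ : ∃ s : ℝ, 1 < s ∧ s * ‖ζ‖ < r := by
    rcases eq_or_ne ζ 0 with rfl | h0
    · exact ⟨2, by norm_num, by simpa using hr⟩
    have h0' := norm_pos_iff.2 h0
    obtain ⟨s, h1, h2⟩ := exists_between ((one_lt_div h0').2 hζ)
    exact ⟨s, h1, (lt_div_iff₀ h0').1 h2⟩
  have hmem : ∀ t ∈ ball (0 : ℂ) s, t • ζ ∈ ball (0 : Cn n) r := by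
    intro t ht
    rw [mem_ball_zero_iff] at ht ⊢
    rw [norm_smul]
    exact (mul_le_mul_of_nonneg_right ht.le (norm_nonneg _)).trans_lt hs
  have hd : DifferentiableOn ℂ (fun t : ℂ => h (φ (t • ζ))) (ball 0 s) := fun t ht =>
    (DifferentiableAt.comp (f := fun t : ℂ => t • ζ) t
      ((hφ _ (hmem t ht)).differentiableAt_comp hΩ hh (hm (hmem t ht)))
      (by fun_prop)).differentiableWithinAt
  have h1 := Complex.hasSum_taylorSeries_on_ball hd
    (z := 1) (by simpa using hs1)
  have h2 : ∀ k, taylorCoeff hom h k ζ (φ 0) =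
      (k.factorial : ℂ)⁻¹ * iteratedDeriv k (fun t : ℂ => h (φ (t • ζ))) 0 := fun k => by
    simpa using taylorCoeff_eq hom h k ζ (hφ 0 (mem_ball_self hr))
  simp only [sub_zero, one_pow, one_smul, smul_eq_mul, one_mul] at h1
  simpa only [h2] using h1

end TaylorCoefficients

/-! ### Uniform Cauchy estimates and enlargement of developing maps. -/

section UniformEstimates

variable {n : ℕ} {X : Type*} [TopologicalSpace X] [ChartedSpace (Cn n) X]
  [IsManifold 𝓘(ℂ, Cn n) ω X] {om : Fin n → ∀ x : X, Cotangent n X x} {a : X}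
  {Ω : Set X} {f h : X → ℂ}

/-- Near each point there are developing maps on polydisks of a fixed radius. -/
theorem exists_uniform_radius_nhds (hom : CondA om) (a : X) : ∃ ε > 0, ∀ᶠ x in 𝓝 a,
    ∃ φ : Cn n → X, φ 0 = x ∧ ∀ z ∈ ball (0 : Cn n) ε, IsDevAt om φ z := by
  obtain ⟨e, he, hx⟩ := hom.exists_isDevChart a
  obtain ⟨ε, hε, hb⟩ := Metric.isOpen_iff.1 e.open_target _ (e.map_source hx)
  refine ⟨ε / 2, by positivity, ?_⟩
  filter_upwards [e.open_source.mem_nhds hx,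
    (e.continuousAt hx).preimage_mem_nhds (ball_mem_nhds _ (half_pos hε))] with x hx1 hx2
  refine ⟨fun w => e.symm (e x + w), by simpa using e.left_inv hx1, fun z hz => ?_⟩
  refine he.isDevAt (hb ?_)
  rw [mem_preimage, mem_ball_iff_norm] at hx2
  rw [mem_ball_zero_iff] at hz
  rw [mem_ball_iff_norm]
  calc ‖e x + z - e a‖ = ‖(e x - e a) + z‖ := by congr 1; abel
    _ ≤ _ := norm_add_le _ _
    _ < ε := by linarith

/-- This is where relative compactness of `Ω` enters, with `S` its closure. The developing maps may
leave `Ω`. -/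
theorem exists_uniform_radius (hom : CondA om) {S : Set X} (hS : IsCompact S) : ∃ ε > 0,
    ∀ x ∈ S, ∃ φ : Cn n → X, φ 0 = x ∧ ∀ z ∈ ball (0 : Cn n) ε, IsDevAt om φ z := by
  refine hS.induction_on (p := fun S => ∃ ε > 0, ∀ x ∈ S, ∃ φ : Cn n → X, φ 0 = x ∧
    ∀ z ∈ ball (0 : Cn n) ε, IsDevAt om φ z) ⟨1, one_pos, by simp⟩ ?_ ?_ ?_
  · rintro s t hst ⟨ε, hε, ht⟩
    exact ⟨ε, hε, fun x hx => ht x (hst hx)⟩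
  · rintro s t ⟨ε, hε, hs⟩ ⟨ε', hε', ht⟩
    refine ⟨min ε ε', lt_min hε hε', ?_⟩
    rintro x (hx | hx)
    · obtain ⟨φ, h0, hφ⟩ := hs x hx
      exact ⟨φ, h0, fun z hz => hφ z (ball_subset_ball (min_le_left _ _) hz)⟩
    · obtain ⟨φ, h0, hφ⟩ := ht x hx
      exact ⟨φ, h0, fun z hz => hφ z (ball_subset_ball (min_le_right _ _) hz)⟩
  · intro x _
    obtain ⟨ε, hε, hev⟩ := exists_uniform_radius_nhds hom x
    exact ⟨_, mem_nhdsWithin_of_mem_nhds hev, ε, hε, fun y hy => hy⟩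

theorem rho_pos (hom : CondA om) (hΩ : IsOpen Ω) (ha : a ∈ Ω) : 0 < rho om a Ω := by
  obtain ⟨e, he, hx⟩ := hom.exists_isDevChart a
  have hO : IsOpen (e.target ∩ e.symm ⁻¹' Ω) := e.symm.isOpen_inter_preimage hΩ
  obtain ⟨ε, hε, hb⟩ := Metric.isOpen_iff.1 hO (e a)
    ⟨e.map_source hx, by simpa [e.left_inv hx] using ha⟩
  have hmem : ∀ z ∈ ball (0 : Cn n) ε, e a + z ∈ e.target ∩ e.symm ⁻¹' Ω := fun z hz =>
    hb (by simpa using hz)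
  exact (ENNReal.ofReal_pos.2 hε).trans_le (le_rho (φ := fun w => e.symm (e a + w)) hε
    (by simpa using e.left_inv hx) (fun z hz => he.isDevAt (hmem z hz).1)
    fun z hz => (hmem z hz).2)

/-- Cauchy's estimate, uniformly near a point of `Ω`. -/
theorem exists_bound_taylorCoeff_nhds (hom : CondA om) (hΩ : IsOpen Ω) (hh : h ∈ Hol (n := n) Ω)
    {R r : ℝ} (hR : 0 < R) (hr : 0 < r) (hRa : ENNReal.ofReal R < rho om a Ω) :
    ∃ M, ∀ᶠ x in 𝓝 a, ∀ (k : ℕ) (v : Cn n), ‖v‖ ≤ r →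
      ‖taylorCoeff hom h k v x‖ * (R / r) ^ k ≤ M := by
  obtain ⟨s, hs, hRs, φ, h0, hφ, hm⟩ := (lt_rho_iff hom).1 hRa
  rw [ENNReal.ofReal_lt_ofReal_iff hs] at hRs
  -- The gap `s' - R` is the room for moving the centre: polydisks of radius `R` about points of
  -- size less than `s' - R` stay in the compact polydisk of radius `s'`, where `h ∘ φ` is bounded.
  obtain ⟨s', hRs', hs's⟩ := exists_between hRs
  have hsub : closedBall (0 : Cn n) s' ⊆ ball 0 s := closedBall_subset_ball hs's
  have hcont : ContinuousOn (fun w => h (φ w)) (closedBall 0 s') := fun w hw =>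
    ((hφ w (hsub hw)).differentiableAt_comp hΩ hh (hm (hsub hw))).continuousAt.continuousWithinAt
  obtain ⟨M, hM⟩ := (isCompact_closedBall (0 : Cn n) s').exists_bound_of_continuousOn hcont
  refine ⟨M, ?_⟩
  obtain ⟨e, he, c, hc, hev⟩ := hφ 0 (mem_ball_self hs)
  have ha : a = e.symm c := by rw [← h0, hev.self_of_nhds, add_zero]
  rw [add_zero] at hc
  have hae : a ∈ e.source := ha ▸ e.map_target hc
  have hea : e a - c = 0 := by rw [ha, e.right_inv hc, sub_self]
  have ht : Filter.Tendsto (fun x => e x - c) (𝓝 a) (𝓝 0) := by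
    have : Filter.Tendsto (fun x => e x - c) (𝓝 a) (𝓝 (e a - c)) :=
      (e.continuousAt hae).sub continuousAt_const
    rwa [hea] at this
  filter_upwards [e.open_source.mem_nhds hae, ht.eventually hev,
    ht.eventually (ball_mem_nhds 0 (sub_pos.2 hRs'))] with x hx1 hx2 hx3 k v hv
  have hx : φ (e x - c) = x := by rw [hx2, add_sub_cancel, e.left_inv hx1]
  rw [dist_zero_right] at hx3
  rw [← hx]
  refine norm_taylorCoeff_mul_pow_le hom hΩ hh k (by positivity) fun t ht => ?_
  have hball : e x - c + t • v ∈ closedBall (0 : Cn n) s' := by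
    rw [mem_closedBall_zero_iff]
    calc ‖e x - c + t • v‖ ≤ ‖e x - c‖ + ‖t‖ * ‖v‖ := (norm_add_le _ _).trans (by rw [norm_smul])
      _ ≤ ‖e x - c‖ + R / r * r := by gcongr
      _ = ‖e x - c‖ + R := by rw [div_mul_cancel₀ _ hr.ne']
      _ ≤ s' := by linarith
  exact ⟨hφ _ (hsub hball), hm (hsub hball), hM _ hball⟩

/-- Cauchy's estimate with the radii `t |f|`, uniformly on a compact set where `|f| ≤ ρ`. -/
theorem exists_bound_taylorCoeff_of_isCompact (hom : CondA om) (hΩ : IsOpen Ω)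
    (hf : f ∈ Hol (n := n) Ω) (hh : h ∈ Hol (n := n) Ω) {K : Set X} (hK : IsCompact K)
    (hKΩ : K ⊆ Ω) (hfK : ∀ x ∈ K, ‖f x‖ₑ ≤ rho om x Ω) {t r : ℝ} (ht0 : 0 < t) (ht1 : t < 1)
    (hr : 0 < r) : ∃ M, ∀ x ∈ K, ∀ (k : ℕ) (v : Cn n), ‖v‖ ≤ r →
      ‖taylorCoeff hom h k v x‖ * (t * ‖f x‖ / r) ^ k ≤ M := by
  refine hK.induction_on (p := fun S => ∃ M, ∀ x ∈ S, ∀ (k : ℕ) (v : Cn n), ‖v‖ ≤ r →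
      ‖taylorCoeff hom h k v x‖ * (t * ‖f x‖ / r) ^ k ≤ M) ⟨0, by simp⟩ ?_ ?_ ?_
  · rintro s s' hst ⟨M, hM⟩
    exact ⟨M, fun x hx => hM x (hst hx)⟩
  · rintro s s' ⟨M, hM⟩ ⟨M', hM'⟩
    refine ⟨max M M', ?_⟩
    rintro x (hx | hx) k v hv
    · exact (hM x hx k v hv).trans (le_max_left _ _)
    · exact (hM' x hx k v hv).trans (le_max_right _ _)
  · intro x hx
    -- The factor `t < 1` makes the inequality strict, except at zeros of `f`, where positivity of
    -- `ρ` is used. A radius `R` strictly in between then serves all nearby points, by continuity of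
    -- `f` alone.
    have hlt : ENNReal.ofReal (t * ‖f x‖) < rho om x Ω := by
      rcases eq_or_ne (f x) 0 with h0 | h0
      · simpa [h0] using rho_pos hom hΩ (hKΩ hx)
      · refine lt_of_lt_of_le ?_ (hfK x hx)
        have := norm_pos_iff.2 h0
        rw [← ofReal_norm, ENNReal.ofReal_lt_ofReal_iff this]
        nlinarith
    obtain ⟨R, -, hR1, hR2⟩ := ENNReal.lt_iff_exists_real_btwn.1 hlt
    have hRpos : 0 < R := by
      by_contra! hneg
      simp [ENNReal.ofReal_of_nonpos hneg] at hR1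
    rw [ENNReal.ofReal_lt_ofReal_iff hRpos] at hR1
    obtain ⟨M, hM⟩ := exists_bound_taylorCoeff_nhds hom hΩ hh hRpos hr hR2
    have hfx : ContinuousAt f x := (Hol.continuousOn hf).continuousAt (hΩ.mem_nhds (hKΩ hx))
    have hev : ∀ᶠ y in 𝓝 x, t * ‖f y‖ < R :=
      (hfx.norm.const_mul t).eventually_lt_const hR1
    refine ⟨_, mem_nhdsWithin_of_mem_nhds (hM.and hev), M, ?_⟩
    rintro y ⟨hy1, hy2⟩ k v hv
    refine le_trans ?_ (hy1 k v hv)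
    gcongr

/-- The estimate persists on the holomorphically convex hull. -/
theorem norm_taylorCoeff_le_of_mem_holHull (hom : CondA om) (hΩ : IsOpen Ω)
    (hf : f ∈ Hol (n := n) Ω) (hh : h ∈ Hol (n := n) Ω) {K : Set X} {s M : ℝ} (hs : 0 ≤ s) {k : ℕ}
    {v : Cn n} (hM : ∀ x ∈ K, ‖taylorCoeff hom h k v x‖ * (s * ‖f x‖) ^ k ≤ M)
    (ha : a ∈ holHull n K Ω) (hM0 : 0 ≤ M) :
    ‖taylorCoeff hom h k v a‖ * (s * ‖f a‖) ^ k ≤ M := by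
  -- The heart of the argument: the quantity bounded on `K` is the modulus of a function in `𝒪(Ω)`,
  -- to which the definition of the hull applies.
  have hmem : (fun x => taylorCoeff hom h k v x * ((s : ℂ) * f x) ^ k) ∈ Hol (n := n) Ω := by
    have h1 : MDifferentiableOn 𝓘(ℂ, Cn n) 𝓘(ℂ, ℂ) (fun x => ((s : ℂ) * f x) ^ k) Ω := by
      have hg : Differentiable ℂ fun z : ℂ => ((s : ℂ) * z) ^ k := by fun_prop
      exact hg.mdifferentiable.comp_mdifferentiableOn hf
    exact fun x hx => (taylorCoeff_mem_hol hom hΩ hh k v x hx).mul (h1 x hx)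
  have hnorm : ∀ x, ‖taylorCoeff hom h k v x * ((s : ℂ) * f x) ^ k‖ =
      ‖taylorCoeff hom h k v x‖ * (s * ‖f x‖) ^ k := fun x => by
    rw [norm_mul, norm_pow, norm_mul, Complex.norm_real, Real.norm_of_nonneg hs]
  have h2 := (ha.2 _ hmem).trans (iSup₂_le fun y hy => show _ ≤ ENNReal.ofReal M by
    rw [← ofReal_norm, hnorm]
    exact ENNReal.ofReal_le_ofReal (hM y hy))
  rwa [← ofReal_norm, hnorm, ENNReal.ofReal_le_ofReal_iff hM0] at h2

/-- A developing map into a set where the radii of developing maps are at least `ε` extends to a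
polydisk whose radius is larger by `ε`. -/
theorem exists_extension [T2Space X] (hom : CondA om) {φ : Cn n → X} {r ε : ℝ} (hr : 0 < r)
    (hε : 0 < ε) (hφ : ∀ z ∈ ball (0 : Cn n) r, IsDevAt om φ z)
    (hu : ∀ z ∈ ball (0 : Cn n) r, ∃ ψ : Cn n → X, ψ 0 = φ z ∧
      ∀ w ∈ ball (0 : Cn n) ε, IsDevAt om ψ w) :
    ∃ φ' : Cn n → X, (∀ z ∈ ball (0 : Cn n) (r + ε), IsDevAt om φ' z) ∧
      EqOn φ' φ (ball 0 r) := by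
  have : Nonempty X := ⟨φ 0⟩
  choose! ψ hψ0 hψ using hu
  -- The contraction by `r / (r + ε)` sends each `z` to a centre in the old polydisk at distance
  -- less than `ε` from `z`. The extension at `z` uses the patch at that centre; patches agree
  -- because each agrees with `φ` on the old polydisk and intersections of balls are convex.
  have hσ : ∀ z ∈ ball (0 : Cn n) (r + ε), ((r / (r + ε) : ℝ) : ℂ) • z ∈ ball (0 : Cn n) r ∧
      z ∈ ball (((r / (r + ε) : ℝ) : ℂ) • z) ε := by
    intro z hz
    rw [mem_ball_zero_iff] at hz
    constructor
    · rw [mem_ball_zero_iff, norm_smul, Complex.norm_real, Real.norm_of_nonneg (by positivity)]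
      calc r / (r + ε) * ‖z‖ < r / (r + ε) * (r + ε) := by gcongr
        _ = r := by field_simp
    · rw [mem_ball_iff_norm]
      have : z - ((r / (r + ε) : ℝ) : ℂ) • z = ((ε / (r + ε) : ℝ) : ℂ) • z := by
        have h1 : (1 : ℂ) = ((r / (r + ε) : ℝ) : ℂ) + ((ε / (r + ε) : ℝ) : ℂ) := by
          rw [← Complex.ofReal_add, ← add_div, div_self (by positivity), Complex.ofReal_one]
        rw [sub_eq_iff_eq_add', ← add_smul, ← h1, one_smul]
      rw [this, norm_smul, Complex.norm_real, Real.norm_of_nonneg (by positivity)]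
      calc ε / (r + ε) * ‖z‖ < ε / (r + ε) * (r + ε) := by gcongr
        _ = ε := by field_simp
  have hdev : ∀ c ∈ ball (0 : Cn n) r, ∀ u ∈ ball c ε, IsDevAt om (fun u => ψ c (-c + u)) u :=
    fun c hc u hu => (hψ c hc _ (by
      rw [mem_ball_iff_norm] at hu; rwa [mem_ball_zero_iff, neg_add_eq_sub])).comp_add
  have hagree : ∀ c ∈ ball (0 : Cn n) r, ∀ u ∈ ball c ε ∩ ball 0 r, ψ c (-c + u) = φ u := by
    intro c hc
    exact eqOn_of_isDevAt hom ((convex_ball c ε).inter (convex_ball (0 : Cn n) r)).isPreconnected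
      (fun u hu => hdev c hc u hu.1) (fun u hu => hφ u hu.2) (z := c) ⟨mem_ball_self hε, hc⟩
      (by simpa using hψ0 c hc)
  set σ : Cn n → Cn n := fun z => ((r / (r + ε) : ℝ) : ℂ) • z with hσdef
  have hσc : Continuous σ := by fun_prop
  refine ⟨fun z => ψ (σ z) (-σ z + z), fun z hz => ?_, fun z hz => ?_⟩
  · refine (hdev (σ z) (hσ z hz).1 z (hσ z hz).2).congr ?_
    filter_upwards [isOpen_ball.mem_nhds hz, isOpen_ball.mem_nhds (hσ z hz).2,
      hσc.continuousAt.preimage_mem_nhds (ball_mem_nhds (σ z) hε)] with w hw1 hw2 hw3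
    exact eqOn_of_isDevAt hom
      ((convex_ball (σ w) ε).inter (convex_ball (σ z) ε)).isPreconnected
      (fun u hu => hdev (σ w) (hσ w hw1).1 u hu.1) (fun u hu => hdev (σ z) (hσ z hz).1 u hu.2)
      (z := σ z) ⟨mem_ball_comm.1 hw3, mem_ball_self hε⟩
      (by
        rw [hagree (σ w) (hσ w hw1).1 (σ z) ⟨mem_ball_comm.1 hw3, (hσ z hz).1⟩, neg_add_cancel,
          hψ0 _ (hσ z hz).1])
      ⟨(hσ w hw1).2, hw2⟩
  · have hz' : z ∈ ball (0 : Cn n) (r + ε) := ball_subset_ball (by linarith) hz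
    exact hagree (σ z) (hσ z hz').1 z ⟨(hσ z hz').2, hz⟩

end UniformEstimates

/-! ### The Cartan–Thullen argument. -/

section CartanThullenTheorem

variable {n : ℕ} {X : Type*} [TopologicalSpace X] [ChartedSpace (Cn n) X]
  {om : Fin n → ∀ x : X, Cotangent n X x} {a : X}
  {Ω : Set X} {f h : X → ℂ} {φ : Cn n → X}

/-- A developing map on a polydisk to which all functions in `𝒪(Ω)` extend does not leave a domain
of holomorphy `Ω`. -/
theorem mapsTo_of_isDomainOfHolomorphy (hΩ : IsDomainOfHolomorphy n Ω) {r : ℝ}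
    (hφ : ∀ z ∈ ball (0 : Cn n) r, IsDevAt om φ z) (h0 : φ 0 ∈ Ω)
    (hext : ∀ h ∈ Hol (n := n) Ω, ∃ H : Cn n → ℂ, DifferentiableOn ℂ H (ball 0 r) ∧
      (fun w => h (φ w)) =ᶠ[𝓝 0] H) : MapsTo φ (ball 0 r) Ω := by
  obtain ⟨hΩo, -, hdom⟩ := hΩ
  intro ζ hζ
  by_contra hζΩ
  have hr : 0 < r := pos_of_mem_ball hζ
  have hseg : ∀ t ∈ Icc (0 : ℝ) 1, (t : ℂ) • ζ ∈ ball (0 : Cn n) r := fun t ht =>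
    ofReal_smul_mem_ball hζ ht
  have hline : Continuous fun t : ℝ => (t : ℂ) • ζ := by fun_prop
  have hφc : ContinuousOn φ (ball 0 r) := fun z hz => (hφ z hz).continuousAt.continuousWithinAt
  have hγ : ContinuousOn (fun t : ℝ => φ ((t : ℂ) • ζ)) (Icc 0 1) :=
    hφc.comp hline.continuousOn hseg
  -- the first exit time
  have hcl : IsClosed (Icc (0 : ℝ) 1 ∩ (fun t : ℝ => φ ((t : ℂ) • ζ)) ⁻¹' Ωᶜ) :=
    hγ.preimage_isClosed_of_isClosed isClosed_Icc hΩo.isClosed_compl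
  obtain ⟨t₀, ⟨ht₀, ht₀Ω⟩, hmin⟩ :=
    (isCompact_Icc.of_isClosed_subset hcl inter_subset_left).exists_isLeast
      ⟨1, by simp, by simpa using hζΩ⟩
  have hlt : ∀ t, 0 ≤ t → t < t₀ → φ ((t : ℂ) • ζ) ∈ Ω := by
    intro t h1 h2
    by_contra h3
    exact absurd (hmin ⟨⟨h1, h2.le.trans ht₀.2⟩, h3⟩) (not_le.2 h2)
  have ht₀pos : 0 < t₀ := by
    refine lt_of_le_of_ne ht₀.1 ?_
    rintro rfl
    exact ht₀Ω (by simpa using h0)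
  set ζ₀ : Cn n := (t₀ : ℂ) • ζ with hζ₀
  have hζ₀r : ζ₀ ∈ ball (0 : Cn n) r := hseg t₀ ht₀
  have hb : φ ζ₀ ∈ frontier Ω := by
    rw [hΩo.frontier_eq]
    refine ⟨mem_closure_iff_frequently.2 ?_, ht₀Ω⟩
    have h1 : Filter.Tendsto (fun t : ℝ => φ ((t : ℂ) • ζ)) (𝓝[<] t₀) (𝓝 (φ ζ₀)) :=
      (ContinuousAt.comp (f := fun t : ℝ => (t : ℂ) • ζ) (hφ ζ₀ hζ₀r).continuousAt
        hline.continuousAt).tendsto.mono_left nhdsWithin_le_nhds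
    refine h1.frequently (Filter.Eventually.frequently ?_)
    filter_upwards [Ioo_mem_nhdsLT ht₀pos] with t ht
    exact hlt t ht.1.le ht.2
  obtain ⟨e, he, c, hc, hev⟩ := hφ ζ₀ hζ₀r
  have hct : ∀ᶠ w in 𝓝 ζ₀, c + w ∈ e.target :=
    (by fun_prop : Continuous fun w => c + w).continuousAt.eventually_mem
      (e.open_target.mem_nhds hc)
  obtain ⟨δ, hδ, hball⟩ := Metric.eventually_nhds_iff_ball.1
    ((hev.and hct).and (isOpen_ball.eventually_mem hζ₀r))
  -- a point of the segment in `Ω` which is close to the exit point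
  obtain ⟨t₁, ⟨ht₁0, ht₁⟩, hζ₁⟩ : ∃ t₁ ∈ Ioo 0 t₀, (t₁ : ℂ) • ζ ∈ ball ζ₀ δ := by
    have h1 : ∀ᶠ t in 𝓝[<] t₀, ((t : ℝ) : ℂ) • ζ ∈ ball ζ₀ δ :=
      (hline.tendsto t₀).mono_left nhdsWithin_le_nhds |>.eventually (ball_mem_nhds _ hδ)
    obtain ⟨t, ht1, ht2⟩ := (h1.and (Ioo_mem_nhdsLT ht₀pos)).exists
    exact ⟨t, ht2, ht1⟩
  set ζ₁ : Cn n := (t₁ : ℂ) • ζ with hζ₁def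
  -- a convex neighbourhood of the segment `[0, ζ₁]` which is mapped to `Ω`
  have hO : IsOpen (ball (0 : Cn n) r ∩ φ ⁻¹' Ω) := hφc.isOpen_inter_preimage isOpen_ball hΩo
  have hsegO : segment ℝ 0 ζ₁ ⊆ ball (0 : Cn n) r ∩ φ ⁻¹' Ω := by
    rw [segment_eq_image]
    rintro _ ⟨s, hs, rfl⟩
    have hpt : (1 - s) • (0 : Cn n) + s • ζ₁ = ((s * t₁ : ℝ) : ℂ) • ζ := by
      simp only [smul_zero, zero_add, hζ₁def, Complex.ofReal_mul, mul_smul, Complex.coe_smul]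
    have hst : s * t₁ < t₀ := (mul_le_of_le_one_left ht₁0.le hs.2).trans_lt ht₁
    have hs0 : 0 ≤ s * t₁ := mul_nonneg hs.1 ht₁0.le
    change (1 - s) • (0 : Cn n) + s • ζ₁ ∈ _
    rw [hpt]
    exact ⟨hseg _ ⟨hs0, hst.le.trans ht₀.2⟩, hlt _ hs0 hst⟩
  have hcomp : IsCompact (segment ℝ 0 ζ₁) := by
    rw [segment_eq_image]
    exact isCompact_Icc.image (by fun_prop)
  -- On this convex neighbourhood `φ` stays in `Ω`, so the identity theorem carries `h ∘ φ = H` from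
  -- `0` to `ζ₁`. It could not be applied on the whole polydisk, where `φ` may leave `Ω`.
  obtain ⟨η, hη, hN⟩ := hcomp.exists_thickening_subset_open hO hsegO
  have hconv : Convex ℝ (thickening η (segment ℝ 0 ζ₁)) := (convex_segment _ _).thickening η
  have hU : IsOpen (e.symm '' ball (c + ζ₀) δ) ∧ ball (c + ζ₀) δ ⊆ e.target := by
    have h1 : ball (c + ζ₀) δ ⊆ e.target := fun u hu => by
      have := (hball (u - c) (by
        rw [mem_ball_iff_norm] at hu ⊢; rwa [sub_sub])).1.2
      simpa using this
    exact ⟨e.symm.isOpen_image_of_subset_source isOpen_ball h1, h1⟩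
  have hVsub : ∀ w ∈ ball ζ₁ η ∩ ball ζ₀ δ, w ∈ thickening η (segment ℝ 0 ζ₁) ∧
      φ w = e.symm (c + w) ∧ c + w ∈ ball (c + ζ₀) δ := fun w hw =>
    ⟨mem_thickening_iff.2 ⟨ζ₁, right_mem_segment _ _ _, hw.1⟩, (hball w hw.2).1.1, by
      simpa using hw.2⟩
  have hVim : φ '' (ball ζ₁ η ∩ ball ζ₀ δ) = e.symm '' ((fun u => u - c) ⁻¹' (ball ζ₁ η ∩ ball ζ₀ δ)) := by
    ext x
    constructor
    · rintro ⟨w, hw, rfl⟩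
      exact ⟨c + w, by simpa using hw, (hVsub w hw).2.1.symm⟩
    · rintro ⟨u, hu, rfl⟩
      exact ⟨u - c, hu, by rw [(hVsub _ hu).2.1]; simp⟩
  refine hdom ⟨φ ζ₀, hb, e.symm '' ball (c + ζ₀) δ, φ '' (ball ζ₁ η ∩ ball ζ₀ δ), hU.1, ?_, ?_, ?_,
    ?_, ?_, ?_⟩
  · exact ((convex_ball _ _).isConnected (nonempty_ball.2 hδ)).image _
      (e.continuousOn_symm.mono hU.2)
  · exact ⟨c + ζ₀, mem_ball_self hδ, ((hball ζ₀ (mem_ball_self hδ)).1.1).symm⟩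
  · rw [hVim]
    refine e.symm.isOpen_image_of_subset_source
      ((isOpen_ball.inter isOpen_ball).preimage (by fun_prop)) fun u hu => ?_
    have := hU.2 (hVsub _ hu).2.2
    simpa using this
  · exact ⟨φ ζ₁, ζ₁, ⟨mem_ball_self hη, hζ₁⟩, rfl⟩
  · rintro _ ⟨w, hw, rfl⟩
    obtain ⟨h1, h2, h3⟩ := hVsub w hw
    exact ⟨⟨c + w, h3, h2.symm⟩, (hN h1).2⟩
  · intro h hh
    obtain ⟨H, hH, hH0⟩ := hext h hh
    have heq : EqOn (fun w => h (φ w) - H w) 0 (thickening η (segment ℝ 0 ζ₁)) := by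
      refine eqOn_zero_of_convex_of_eventuallyEq isOpen_thickening (fun x hx y hy t ht => by
        simpa using hconv.add_smul_sub_mem hx hy ht) ?_
        (self_subset_thickening hη _ (left_mem_segment _ _ _)) ?_
      · intro w hw
        exact (((hφ w (hN hw).1).differentiableAt_comp hΩo hh (hN hw).2).sub
          (hH.differentiableAt (isOpen_ball.mem_nhds (hN hw).1))).differentiableWithinAt
      · filter_upwards [hH0] with w hw
        simp [hw]
    -- Near the exit point `e - c` inverts `φ`, so `H` moved to `X` is the forbidden continuation of
    -- `h`.
    refine ⟨fun x => H (e x - c), ?_, ?_⟩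
    · rintro _ ⟨u, hu, rfl⟩
      have hsrc : e.symm u ∈ e.source := e.map_target (hU.2 hu)
      have hu' : e (e.symm u) - c ∈ ball (0 : Cn n) r := by
        rw [e.right_inv (hU.2 hu)]
        refine (hball _ ?_).2
        rw [mem_ball_iff_norm] at hu ⊢; rwa [sub_sub]
      have h1 : DifferentiableAt ℂ (fun y => H (y - c)) (e (e.symm u)) :=
        DifferentiableAt.comp (f := fun y : Cn n => y - c) _
          (hH.differentiableAt (isOpen_ball.mem_nhds hu')) (by fun_prop)
      exact (h1.mdifferentiableAt.comp _ (he.mdifferentiableAt hsrc)).mdifferentiableWithinAt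
    · rintro _ ⟨w, hw, rfl⟩
      obtain ⟨h1, h2, h3⟩ := hVsub w hw
      have h4 := heq h1
      simp only [Pi.zero_apply, sub_eq_zero] at h4
      change h (φ w) = H (e (φ w) - c)
      rw [h4, h2, e.right_inv (hU.2 h3), add_sub_cancel_left]

variable [IsManifold 𝓘(ℂ, Cn n) ω X]

/-- At points `a` of the hull of `K`, the functions in `𝒪(Ω)`, read in the coordinates at `a`,
extend to the polydisks of radius less than `|f a|`. -/
theorem exists_holomorphic_extension (hom : CondA om) (hΩ : IsOpen Ω)
    (hf : f ∈ Hol (n := n) Ω) (hh : h ∈ Hol (n := n) Ω) {K : Set X} (hK : IsCompact K)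
    (hKΩ : K ⊆ Ω) (hfK : ∀ x ∈ K, ‖f x‖ₑ ≤ rho om x Ω) (ha : a ∈ holHull n K Ω) {r : ℝ}
    (hr : 0 < r) (hrf : r < ‖f a‖) (hφ : IsDevAt om φ 0) (h0 : φ 0 = a) :
    ∃ H : Cn n → ℂ, DifferentiableOn ℂ H (ball 0 r) ∧ (fun w => h (φ w)) =ᶠ[𝓝 0] H := by
  have hfa : 0 < ‖f a‖ := hr.trans hrf
  -- `t < 1` is required by the estimate on `K`, and `t > r / ‖f a‖` makes `t ‖f a‖ / r > 1`, so the
  -- coefficients at `a` decay geometrically.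
  obtain ⟨t, ht1, ht2⟩ := exists_between ((div_lt_one hfa).2 hrf)
  have ht0 : 0 < t := (by positivity : 0 < r / ‖f a‖).trans ht1
  obtain ⟨M, hM⟩ := exists_bound_taylorCoeff_of_isCompact hom hΩ hf hh hK hKΩ hfK ht0 ht2 hr
  have hq : 1 < t / r * ‖f a‖ := by
    rw [div_mul_eq_mul_div, one_lt_div hr]; exact (div_lt_iff₀ hfa).1 ht1
  have hbound : ∀ (k : ℕ), ∀ v ∈ ball (0 : Cn n) r,
      ‖taylorCoeff hom h k v a‖ ≤ max M 0 * (t / r * ‖f a‖)⁻¹ ^ k := by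
    intro k v hv
    have h1 := norm_taylorCoeff_le_of_mem_holHull hom hΩ hf hh (K := K) (s := t / r) (M := max M 0)
      (k := k) (v := v) (by positivity) (fun x hx => by
        rw [div_mul_eq_mul_div]
        exact (hM x hx k v (mem_ball_zero_iff.1 hv).le).trans (le_max_left _ _))
      ha (le_max_right _ _)
    rw [inv_pow, ← div_eq_mul_inv, le_div_iff₀ (by positivity)]
    exact h1
  refine ⟨fun v => ∑' k, taylorCoeff hom h k v a, ?_, ?_⟩
  · exact differentiableOn_tsum_of_summable_norm_ball
      ((summable_geometric_of_lt_one (by positivity) (inv_lt_one_of_one_lt₀ hq)).mul_left _)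
      (fun k => (differentiable_taylorCoeff hom hΩ hh k ha.1).differentiableOn) hbound
  · have hev := hφ.eventually.and (hφ.continuousAt.eventually_mem (hΩ.mem_nhds (h0 ▸ ha.1)))
    obtain ⟨δ, hδ, hb⟩ := Metric.eventually_nhds_iff_ball.1 hev
    filter_upwards [ball_mem_nhds 0 hδ] with w hw
    have := hasSum_taylorCoeff hom hΩ hh (fun z hz => (hb z hz).1) (fun z hz => (hb z hz).2) hw
    rw [h0] at this
    exact this.tsum_eq.symm

/-- The Cartan–Thullen inequality on the holomorphically convex hull. -/
theorem enorm_le_rho_of_mem_holHull [T2Space X] (hom : CondA om) (hΩ : IsDomainOfHolomorphy n Ω)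
    (hΩc : IsCompact (closure Ω)) {K : Set X} (hK : IsCompact K) (hKΩ : K ⊆ Ω)
    (hf : f ∈ Hol (n := n) Ω) (hfK : ∀ x ∈ K, ‖f x‖ₑ ≤ rho om x Ω) (ha : a ∈ holHull n K Ω) :
    ‖f a‖ₑ ≤ rho om a Ω := by
  by_contra! hlt
  have hpos := rho_pos hom hΩ.1 ha.1
  obtain ⟨r, -, hr1, hr2⟩ := ENNReal.lt_iff_exists_real_btwn.1 hlt
  have hr : 0 < r := by
    by_contra! hneg
    simp [ENNReal.ofReal_of_nonpos hneg] at hr1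
  have hrf : r < ‖f a‖ := by
    rw [← ofReal_norm] at hr2
    exact (ENNReal.ofReal_lt_ofReal_iff_of_nonneg hr.le).1 hr2
  obtain ⟨ε, hε, hu⟩ := exists_uniform_radius hom hΩc
  have htop : rho om a Ω ≠ ⊤ := (hr1.trans ENNReal.ofReal_lt_top).ne
  have hρ : ENNReal.ofReal (rho om a Ω).toReal = rho om a Ω := ENNReal.ofReal_toReal htop
  have hρ0 : 0 < (rho om a Ω).toReal := ENNReal.toReal_pos hpos.ne' htop
  -- A developing map into `Ω` of radius `s > ρ - ε` extends to radius `s + ε > ρ`. Cutting back to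
  -- `min (s + ε) r`, still larger than `ρ`, keeps it where all `h` extend.
  have h1 : ENNReal.ofReal ((rho om a Ω).toReal - ε) < rho om a Ω := by
    conv_rhs => rw [← hρ]
    rw [ENNReal.ofReal_lt_ofReal_iff hρ0]
    linarith
  obtain ⟨s, hs, hs1, φ, h0, hφ, hm⟩ := (lt_rho_iff hom).1 h1
  rw [ENNReal.ofReal_lt_ofReal_iff hs] at hs1
  obtain ⟨φ', hφ', heq⟩ := exists_extension hom hs hε hφ
    (fun z hz => hu _ (subset_closure (hm hz)))
  have h0' : φ' 0 = a := by rw [heq (mem_ball_self hs), h0]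
  have hpos' : 0 < min (s + ε) r := lt_min (by positivity) hr
  have hdev : ∀ z ∈ ball (0 : Cn n) (min (s + ε) r), IsDevAt om φ' z := fun z hz =>
    hφ' z (ball_subset_ball (min_le_left _ _) hz)
  have hmaps : MapsTo φ' (ball 0 (min (s + ε) r)) Ω := by
    refine mapsTo_of_isDomainOfHolomorphy hΩ hdev (by rw [h0']; exact ha.1) fun h hh => ?_
    obtain ⟨H, hH, hH0⟩ := exists_holomorphic_extension hom hΩ.1 hf hh hK hKΩ hfK ha hr hrf
      (hdev 0 (mem_ball_self hpos')) h0'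
    exact ⟨H, hH.mono (ball_subset_ball (min_le_right _ _)), hH0⟩
  have h2 := le_rho hpos' h0' hdev hmaps
  have h3 : rho om a Ω < ENNReal.ofReal (min (s + ε) r) := by
    rw [ENNReal.ofReal_min, lt_min_iff]
    refine ⟨?_, hr1⟩
    conv_lhs => rw [← hρ]
    rw [ENNReal.ofReal_lt_ofReal_iff (by positivity)]
    linarith
  exact absurd h2 (not_le.2 h3)

theorem rhoSet_holHull [T2Space X] (hom : CondA om) (hΩ : IsDomainOfHolomorphy n Ω)
    (hΩc : IsCompact (closure Ω)) {K : Set X} (hK : IsCompact K) (hKΩ : K ⊆ Ω) :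
    rhoSet om K Ω = rhoSet om (holHull n K Ω) Ω := by
  refine le_antisymm (le_iInf₂ fun a ha => ?_) (biInf_mono (subset_holHull hKΩ))
  refine le_of_forall_lt fun c hc => ?_
  -- The inequality is applied to constants `r < ρ(K, Ω)` rather than to `ρ(K, Ω)` itself, which may
  -- be infinite.
  obtain ⟨r, hr, hr1, hr2⟩ := ENNReal.lt_iff_exists_real_btwn.1 hc
  have henorm : ‖(r : ℂ)‖ₑ = ENNReal.ofReal r := by
    rw [← ofReal_norm, Complex.norm_real, Real.norm_of_nonneg hr]
  have h1 := enorm_le_rho_of_mem_holHull hom hΩ hΩc hK hKΩ (f := fun _ => (r : ℂ))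
    mdifferentiableOn_const
    (fun x hx => by rw [henorm]; exact hr2.le.trans (iInf₂_le x hx)) ha
  rw [henorm] at h1
  exact hr1.trans_le h1

end CartanThullenTheorem

end CartanThullen

end

theorem theorem1p2 {n : ℕ} {X : Type*} [TopologicalSpace X] [T2Space X] [ConnectedSpace X]
    [ChartedSpace (CartanThullen.Cn n) X] [IsManifold 𝓘(ℂ, CartanThullen.Cn n) ω X]
    (om : Fin n → ∀ x : X, CartanThullen.Cotangent n X x) (hom : CartanThullen.CondA om)
    (Ω : Set X) (hΩ : CartanThullen.IsDomainOfHolomorphy n Ω) (hΩc : IsCompact (closure Ω))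
    (K : Set X) (hK : IsCompact K) (hKΩ : K ⊆ Ω) :
    (∀ f ∈ CartanThullen.Hol (n := n) Ω,
      (∀ a ∈ K, ‖f a‖ₑ ≤ CartanThullen.rho om a Ω) →
        ∀ a ∈ CartanThullen.holHull n K Ω, ‖f a‖ₑ ≤ CartanThullen.rho om a Ω) ∧
    CartanThullen.rhoSet om K Ω = CartanThullen.rhoSet om (CartanThullen.holHull n K Ω) Ω :=
  ⟨fun _ hf hfK _ ha => CartanThullen.enorm_le_rho_of_mem_holHull hom hΩ hΩc hK hKΩ hf hfK ha,
    CartanThullen.rhoSet_holHull hom hΩ hΩc hK hKΩ⟩
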